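/- There is a constant $C>0$ such that for all integers $n\ge 2$ and $r\ge 1$ the following holds. Consider the path $v_0,\dots,v_r$ of length $r$, in which $v_0$ holds an input $x\in\{0,1\}^n$, $v_r$ holds an input $y\in\{0,1\}^n$, and the other nodes hold no input, and let $\mathsf{EQ}_n(x,y)=1$ if $x=y$ and $\mathsf{EQ}_n(x,y)=0$ otherwise. In a distributed quantum Merlin--Arthur (dQMA) protocol on the path, a prover first sends to each node a register of qubits (its certificate), the joint state of all certificates being an arbitrary, possibly entangled, quantum state. Then every node, knowing only its own input (if any), applies a local quantum operation to its certificate, which produces a private memory and a message of qubits for each of its neighbours; all messages are delivered simultaneously in a single round; finally, every node performs a local two-outcome measurement, depending only on its own input (if any), on its private memory and the messages received, and accepts or rejects. The certificate size is the maximum number of qubits of the certificate of a node, and the message size is the maximum number of qubits exchanged between two adjacent nodes. Then there is a dQMA protocol on the path $v_0,\dots,v_r$, with certificate size at most $C\,r^2\log_2 n$ and message size at most $C\,r^2\log_2(n+r)$, that decides $\mathsf{EQ}_n$ with perfect completeness and soundness $1/3$, that is: - if $x=y$, then there is a state of the certificates for which all nodes accept with probability $1$; - if $x\ne y$, then for every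 state of the certificates the probability that all nodes accept is at most $1/3$. -/

import Mathlib

open scoped Matrix ComplexOrder

noncomputable section

/-- Labels of the computational basis of a register of `k` qubits; matrices indexed by
`Qubits k` are the operators on `(ℂ²)^{⊗k}`. -/
abbrev Qubits (k : ℕ) : Type := Fin k → Bool

/-- `n`-bit strings. -/
abbrev BitString (n : ℕ) : Type := Fin n → Bool

/-- Density matrices, i.e. (mixed) quantum states. -/
def IsDensityMatrix {A : Type} [Fintype A] (ρ : Matrix A A ℂ) : Prop :=
  ρ.PosSemidef ∧ ρ.trace = 1

/-- The element `M` of a two-outcome POVM `{M, 1 - M}`. -/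
def IsPOVMElement {A : Type} [Fintype A] [DecidableEq A] (M : Matrix A A ℂ) : Prop :=
  M.PosSemidef ∧ (1 - M).PosSemidef

/-- A quantum operation (completely positive trace-preserving map) from the system with basis `A`
to the system with basis `B`, given by Kraus operators. It may use private randomness, fresh
ancillas and intermediate measurements. -/
structure QuantumOperation (A B : Type) [Fintype A] [DecidableEq A] [Fintype B] where
  /-- index set of the Kraus operators -/
  Idx : Type
  [fintypeIdx : Fintype Idx]
  /-- the Kraus operators -/
  kraus : Idx → Matrix B A ℂ
  sum_kraus : ∑ i, (kraus i)ᴴ * kraus i = 1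

attribute [instance] QuantumOperation.fintypeIdx

/-- The tensor product `⨂ᵥ K v` of a finite family of operators. -/
def tensorAll {V : Type} [Fintype V] {A B : V → Type} (K : ∀ v, Matrix (B v) (A v) ℂ) :
    Matrix (∀ v, B v) (∀ v, A v) ℂ :=
  fun b a => ∏ v, K v (b v) (a v)

/-- A distributed quantum Merlin-Arthur protocol on the graph `G`, where some nodes hold an
`n`-bit input (`none` is the local input of a node that holds no input). -/
structure DQMAProtocol {V : Type} [Fintype V] [DecidableEq V] (G : SimpleGraph V) (n : ℕ) where
  /-- number of qubits of the certificate that the prover sends to a node -/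
  cert : V → ℕ
  /-- `msg v w` is the number of qubits of the message that `v` sends to `w` -/
  msg : V → V → ℕ
  /-- only neighbours communicate -/
  msg_eq_zero : ∀ v w, ¬ G.Adj v w → msg v w = 0
  /-- basis of the private memory that a node keeps during the communication round -/
  Mem : V → Type
  [fintypeMem : ∀ v, Fintype (Mem v)]
  [decidableEqMem : ∀ v, DecidableEq (Mem v)]
  /-- the operation by which a node, knowing its local input only, turns its certificate into its
  private memory and its outgoing messages -/
  send : ∀ v, Option (BitString n) →
    QuantumOperation (Qubits (cert v)) (Mem v × ∀ w, Qubits (msg v w))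
  /-- the "accept" element of the local measurement that a node, knowing its local input only,
  performs on its private memory and its incoming messages -/
  accept : ∀ v, Option (BitString n) →
    Matrix (Mem v × ∀ w, Qubits (msg w v)) (Mem v × ∀ w, Qubits (msg w v)) ℂ
  accept_isPOVMElement : ∀ v inp, IsPOVMElement (accept v inp)

namespace DQMAProtocol

attribute [instance] DQMAProtocol.fintypeMem DQMAProtocol.decidableEqMem

variable {V : Type} [Fintype V] [DecidableEq V] {G : SimpleGraph V} {n : ℕ}

/-- Basis of the joint system of all certificates. -/
abbrev Certs (P : DQMAProtocol G n) : Type := ∀ v, Qubits (P.cert v)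

/-- Basis of the global system before the communication round: each node holds its private memory
and its outgoing messages. -/
abbrev Sent (P : DQMAProtocol G n) : Type := ∀ v, P.Mem v × ∀ w, Qubits (P.msg v w)

/-- Basis of the global system after the communication round: each node holds its private memory
and its incoming messages. -/
abbrev Received (P : DQMAProtocol G n) : Type := ∀ v, P.Mem v × ∀ w, Qubits (P.msg w v)

/-- The communication round: the register sent by `w` to `v` is delivered to `v`. -/
def deliver (P : DQMAProtocol G n) : P.Sent ≃ P.Received where
  toFun s v := ((s v).1, fun w => (s w).2 v)
  invFun s v := ((s v).1, fun w => (s w).2 v)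
  left_inv _ := rfl
  right_inv _ := rfl

/-- The global Kraus operator `⨂ᵥ (kraus operator number i v of node v)` of the sending step. -/
def globalKraus (P : DQMAProtocol G n) (inp : V → Option (BitString n))
    (i : ∀ v, (P.send v (inp v)).Idx) : Matrix P.Sent P.Certs ℂ :=
  tensorAll fun v => (P.send v (inp v)).kraus (i v)

/-- The global state after all nodes have applied their sending operations, with local inputs
`inp`, to the (possibly entangled) state `ρ` of the certificates. -/
def sentState (P : DQMAProtocol G n) (inp : V → Option (BitString n))
    (ρ : Matrix P.Certs P.Certs ℂ) : Matrix P.Sent P.Sent ℂ :=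
  ∑ i : (∀ v, (P.send v (inp v)).Idx), P.globalKraus inp i * ρ * (P.globalKraus inp i)ᴴ

/-- The probability that all nodes accept. -/
def acceptProb (P : DQMAProtocol G n) (inp : V → Option (BitString n))
    (ρ : Matrix P.Certs P.Certs ℂ) : ℝ :=
  (tensorAll (fun v => P.accept v (inp v)) *
    (P.sentState inp ρ).reindex P.deliver P.deliver).trace.re

/-- Local inputs when the two terminals `u` and `w` hold `x` and `y`. -/
def localInput (u w : V) (x y : BitString n) (v : V) : Option (BitString n) :=
  if v = u then some x else if v = w then some y else none

/-- The protocol decides `f`, with terminals `u` and `w`, with completeness `a` and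
soundness `b`. -/
def Decides (P : DQMAProtocol G n) (u w : V) (f : BitString n → BitString n → Bool)
    (a b : ℝ) : Prop :=
  ∀ x y : BitString n,
    (f x y = true →
      ∃ ρ : Matrix P.Certs P.Certs ℂ, IsDensityMatrix ρ ∧
        a ≤ P.acceptProb (localInput u w x y) ρ) ∧
    (f x y = false →
      ∀ ρ : Matrix P.Certs P.Certs ℂ, IsDensityMatrix ρ →
        P.acceptProb (localInput u w x y) ρ ≤ b)

/-- Certificate size in qubits: the maximum over all nodes. -/
def certSize (P : DQMAProtocol G n) : ℕ := Finset.univ.sup P.cert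

/-- Message size in qubits: the maximum over all pairs of nodes of the total length of the
messages they exchange (in both directions). -/
def msgSize (P : DQMAProtocol G n) : ℕ :=
  Finset.univ.sup fun e : V × V => P.msg e.1 e.2 + P.msg e.2 e.1

end DQMAProtocol

/-- The equality function on `n`-bit strings. -/
def EQ (n : ℕ) (x y : BitString n) : Bool := decide (x = y)

end

/-! Each node receives copies of a pair of registers, a left and a right one, honestly all in the
fingerprint state of the input. In one copy, node `0` projects its right register onto the
fingerprint of `x`, the last node projects its left register onto that of `y`, and inner nodes
project their pair onto the symmetric subspace (together `P`). Right registers then move one node to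
the right, and each receiver projects the received register and its own left one onto the symmetric
subspace (together `Q`). The copy accepts with probability `‖Q P ξ‖²` on a pure state `ξ`, and equal
fingerprints in all registers pass with certainty.

For soundness put `ζ = P ξ` and `ε = ‖ζ - Q ζ‖`, and follow the amplitude with which a register is
in the fingerprint of `x`. It is `‖ζ‖` at the right register of node `0`. Within an inner node it is
the same for both registers, since `ζ` is invariant under their swap. Across an edge it drops by at
most `2ε`, since `Q ζ` is swap-invariant there. At the last node it is at most `‖ζ‖/2`, because
fingerprints of distinct inputs have squared overlap at most `1/4`. Hence `‖ζ‖ ≤ 4rε`, and the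
acceptance operator `P Q P` is at most `1 - 1/(16r²)`; see `norm_apply_apply_le_of_chain` and
`posSemidef_smul_one_sub_copyAccept`.

For `32r²` copies the acceptance operator is the tensor power of `P Q P`. By
`Matrix.PosSemidef.smul_one_sub_tensorAll` it is at most `(1 - 1/(16r²))^(32r²) ≤ e⁻² ≤ 1/3` as an
operator, so entanglement between copies or nodes does not help the prover. Reed-Solomon
fingerprints (`exists_fingerprint`) use `O(log n)` qubits. -/

section TensorAll

/-! ### Tensor products of operators -/

variable {V : Type} [Fintype V]

theorem tensorAll_conjTranspose {A B : V → Type} (K : ∀ v, Matrix (B v) (A v) ℂ) :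
    (tensorAll K)ᴴ = tensorAll fun v => (K v)ᴴ := by
  ext a b
  simp [tensorAll, Matrix.conjTranspose_apply]

theorem tensorAll_diagonal {A : V → Type} [∀ v, DecidableEq (A v)] (d : ∀ v, A v → ℂ) :
    tensorAll (fun v => Matrix.diagonal (d v)) = Matrix.diagonal fun a => ∏ v, d v (a v) := by
  ext a b
  by_cases h : a = b
  · subst h
    simp [tensorAll]
  · obtain ⟨v, hv⟩ := Function.ne_iff.mp h
    rw [Matrix.diagonal_apply_ne _ h]
    exact Finset.prod_eq_zero (Finset.mem_univ v) (Matrix.diagonal_apply_ne _ hv)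

theorem tensorAll_one {A : V → Type} [∀ v, DecidableEq (A v)] :
    tensorAll (fun v => (1 : Matrix (A v) (A v) ℂ)) = 1 := by
  have := tensorAll_diagonal (A := A) fun _ _ => 1
  simpa using this

variable [DecidableEq V]

theorem tensorAll_mul {A B C : V → Type} [∀ v, Fintype (B v)]
    (K : ∀ v, Matrix (C v) (B v) ℂ) (L : ∀ v, Matrix (B v) (A v) ℂ) :
    tensorAll K * tensorAll L = tensorAll fun v => K v * L v := by
  ext c a
  simp only [Matrix.mul_apply, tensorAll, ← Finset.prod_mul_distrib]
  rw [Finset.prod_univ_sum, Fintype.piFinset_univ]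

theorem tensorAll_mulVec_prod {A B : V → Type} [∀ v, Fintype (A v)]
    (K : ∀ v, Matrix (B v) (A v) ℂ) (f : ∀ v, A v → ℂ) :
    (tensorAll K *ᵥ fun a => ∏ v, f v (a v)) = fun b => ∏ v, (K v *ᵥ f v) (b v) := by
  ext b
  simp only [Matrix.mulVec, dotProduct, tensorAll, ← Finset.prod_mul_distrib]
  rw [Finset.prod_univ_sum, Fintype.piFinset_univ]

theorem IsStarProjection.tensorAll {A : V → Type} [∀ v, Fintype (A v)]
    {K : ∀ v, Matrix (A v) (A v) ℂ} (hK : ∀ v, IsStarProjection (K v)) :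
    IsStarProjection (_root_.tensorAll K) where
  isIdempotentElem := by
    rw [IsIdempotentElem, tensorAll_mul]
    congr 1
    funext v
    exact (hK v).isIdempotentElem
  isSelfAdjoint := by
    rw [IsSelfAdjoint, Matrix.star_eq_conjTranspose, tensorAll_conjTranspose]
    congr 1
    funext v
    exact (hK v).isSelfAdjoint

end TensorAll

/-! ### Projections, POVM elements and operator inequalities -/

theorem IsStarProjection.posSemidef {A : Type} [Fintype A] {M : Matrix A A ℂ}
    (h : IsStarProjection M) : M.PosSemidef := by
  have h2 : M = Mᴴ * M := by
    rw [← Matrix.star_eq_conjTranspose, h.isSelfAdjoint.star_eq, h.isIdempotentElem.eq]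
  rw [h2]
  exact Matrix.posSemidef_conjTranspose_mul_self M

theorem IsStarProjection.isPOVMElement {A : Type} [Fintype A] [DecidableEq A]
    {M : Matrix A A ℂ} (h : IsStarProjection M) : IsPOVMElement M :=
  ⟨h.posSemidef, h.one_sub.posSemidef⟩

theorem IsPOVMElement.submatrix {A B : Type} [Fintype A] [DecidableEq A] [Fintype B]
    [DecidableEq B] {M : Matrix A A ℂ} (h : IsPOVMElement M) {f : B → A}
    (hf : Function.Injective f) : IsPOVMElement (M.submatrix f f) := by
  refine ⟨h.1.submatrix f, ?_⟩
  have := h.2.submatrix f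
  rwa [Matrix.submatrix_sub, Pi.sub_apply, Pi.sub_apply, Matrix.submatrix_one f hf] at this

theorem IsStarProjection.submatrix_equiv {A B : Type} [Fintype A] [Fintype B]
    {M : Matrix A A ℂ} (h : IsStarProjection M) (e : B ≃ A) :
    IsStarProjection (M.submatrix e e) where
  isIdempotentElem := by
    rw [IsIdempotentElem, Matrix.submatrix_mul_equiv, h.isIdempotentElem.eq]
  isSelfAdjoint := by
    rw [IsSelfAdjoint, Matrix.star_eq_conjTranspose, Matrix.conjTranspose_submatrix,
      ← Matrix.star_eq_conjTranspose, h.isSelfAdjoint.star_eq]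

theorem Matrix.PosSemidef.trace_mul_nonneg {A : Type} [Fintype A]
    {M ρ : Matrix A A ℂ} (hM : M.PosSemidef) (hρ : ρ.PosSemidef) : 0 ≤ (M * ρ).trace := by
  classical
  obtain ⟨B, rfl⟩ : ∃ B : Matrix A A ℂ, M = Bᴴ * B := by
    open scoped MatrixOrder in
    obtain ⟨B, hB⟩ := CStarAlgebra.nonneg_iff_eq_star_mul_self.mp hM.nonneg
    exact ⟨B, hB⟩
  rw [Matrix.mul_assoc, Matrix.trace_mul_comm]
  exact (hρ.mul_mul_conjTranspose_same B).trace_nonneg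

/-- If `0 ≤ N ≤ c`, then `N ⊗ ⋯ ⊗ N ≤ c ^ k`. -/
theorem Matrix.PosSemidef.smul_one_sub_tensorAll {A : Type} [Fintype A] [DecidableEq A]
    {N : Matrix A A ℂ} (hN : N.PosSemidef) {c : ℝ} (hc : ((c : ℂ) • 1 - N).PosSemidef) (k : ℕ) :
    (((c ^ k : ℝ) : ℂ) • 1 - tensorAll fun _ : Fin k => N).PosSemidef := by
  -- Diagonalize `N`: the eigenvalues of the tensor power are the products of `k` eigenvalues of
  -- `N`, all in `[0, c]`.
  obtain ⟨U, d, hU, hU', hN'⟩ : ∃ (U : Matrix A A ℂ) (d : A → ℝ),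
      Uᴴ * U = 1 ∧ U * Uᴴ = 1 ∧ N = U * diagonal (fun a => (d a : ℂ)) * Uᴴ := by
    refine ⟨hN.isHermitian.eigenvectorUnitary, hN.isHermitian.eigenvalues,
      Unitary.coe_star_mul_self _, Unitary.coe_mul_star_self _, ?_⟩
    have := hN.isHermitian.spectral_theorem
    rwa [Unitary.conjStarAlgAut_apply] at this
  have hd : Uᴴ * N * U = diagonal (fun a => (d a : ℂ)) := by
    calc Uᴴ * N * U = (Uᴴ * U) * diagonal (fun a => (d a : ℂ)) * (Uᴴ * U) := by
          rw [hN']; simp only [Matrix.mul_assoc]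
      _ = _ := by rw [hU]; simp
  have hd0 : ∀ a, 0 ≤ d a := fun a => by
    have := hN.conjTranspose_mul_mul_same U
    rw [hd, posSemidef_diagonal_iff] at this
    exact_mod_cast this a
  have hdc : ∀ a, d a ≤ c := fun a => by
    have := hc.conjTranspose_mul_mul_same U
    rw [Matrix.mul_sub, Matrix.sub_mul, hd, Matrix.mul_smul, Matrix.smul_mul, Matrix.mul_one, hU,
      Matrix.smul_one_eq_diagonal, Matrix.diagonal_sub, posSemidef_diagonal_iff] at this
    have := this a
    rw [sub_nonneg] at this
    exact_mod_cast this
  set W : Matrix (Fin k → A) (Fin k → A) ℂ := tensorAll fun _ => U with hW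
  have hWW : W * Wᴴ = 1 := by
    rw [hW, tensorAll_conjTranspose, tensorAll_mul]
    simp only [hU', tensorAll_one]
  have key : ((c ^ k : ℝ) : ℂ) • 1 - tensorAll (fun _ : Fin k => N) =
      W * diagonal (fun s => ((c ^ k : ℝ) : ℂ) - ∏ i, (d (s i) : ℂ)) * Wᴴ := by
    rw [← Matrix.diagonal_sub, Matrix.mul_sub, Matrix.sub_mul, ← Matrix.smul_one_eq_diagonal,
      Matrix.mul_smul, Matrix.smul_mul, Matrix.mul_one, hWW,
      ← tensorAll_diagonal (A := fun _ : Fin k => A) fun _ a => (d a : ℂ), hW,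
      tensorAll_conjTranspose, tensorAll_mul, tensorAll_mul, ← hN']
  rw [key]
  refine PosSemidef.mul_mul_conjTranspose_same (posSemidef_diagonal_iff.mpr fun s => ?_) W
  rw [sub_nonneg]
  have : ∏ i, d (s i) ≤ c ^ k := by
    calc ∏ i, d (s i) ≤ ∏ _i : Fin k, c :=
          Finset.prod_le_prod (fun i _ => hd0 _) fun i _ => hdc _
      _ = c ^ k := by simp
  exact_mod_cast this

/-! ### Soundness of a chain of projective tests -/

section Chain

variable {H : Type*} [NormedAddCommGroup H] [InnerProductSpace ℂ H] [CompleteSpace H]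

theorem IsStarProjection.norm_sq_add {P : H →L[ℂ] H} (hP : IsStarProjection P) (x : H) :
    ‖x‖ ^ 2 = ‖P x‖ ^ 2 + ‖x - P x‖ ^ 2 := by
  have h : inner ℂ (P x) (x - P x) = 0 := by
    rw [← ContinuousLinearMap.adjoint_inner_right, ← ContinuousLinearMap.star_eq_adjoint,
      hP.isSelfAdjoint.star_eq, map_sub, show P (P x) = P x from
        DFunLike.congr_fun hP.isIdempotentElem.eq x, sub_self, inner_zero_right]
  have := norm_add_sq_eq_norm_sq_add_norm_sq_of_inner_eq_zero _ _ h
  rw [add_sub_cancel] at this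
  nlinarith

theorem IsStarProjection.norm_apply_le {P : H →L[ℂ] H} (hP : IsStarProjection P) (x : H) :
    ‖P x‖ ≤ ‖x‖ := by
  have := hP.norm_sq_add x
  exact le_of_sq_le_sq (by nlinarith [sq_nonneg ‖x - P x‖]) (norm_nonneg x)

/-- Since `x` lies in the range of `B`, `‖A x‖² = ⟨x, B A B x⟩ = c ‖x‖²`. For rank-one `A` and `B`,
`c` is the squared overlap of their vectors. -/
theorem IsStarProjection.norm_apply_le_half {A B : H →L[ℂ] H} (hA : IsStarProjection A)
    (hB : IsStarProjection B) {c : ℝ} (hc : c ≤ 1 / 4) (h : B * A * B = (c : ℂ) • B) {x : H}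
    (hx : B x = x) : ‖A x‖ ≤ 1 / 2 * ‖x‖ := by
  have hA' (y z : H) : inner ℂ (A y) z = inner ℂ y (A z) := by
    rw [← ContinuousLinearMap.adjoint_inner_right, ← ContinuousLinearMap.star_eq_adjoint,
      hA.isSelfAdjoint.star_eq]
  have hB' (y z : H) : inner ℂ (B y) z = inner ℂ y (B z) := by
    rw [← ContinuousLinearMap.adjoint_inner_right, ← ContinuousLinearMap.star_eq_adjoint,
      hB.isSelfAdjoint.star_eq]
  have h1 : B (A x) = (c : ℂ) • x := by
    have := DFunLike.congr_fun h x
    change B (A (B x)) = (c : ℂ) • B x at this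
    rwa [hx] at this
  have h2 : inner ℂ (A x) (A x) = (c : ℂ) * inner ℂ x x := by
    rw [hA', show A (A x) = A x from DFunLike.congr_fun hA.isIdempotentElem.eq x]
    calc inner ℂ x (A x) = inner ℂ (B x) (A x) := by rw [hx]
      _ = _ := by rw [hB', h1, inner_smul_right]
  rw [inner_self_eq_norm_sq_to_K, inner_self_eq_norm_sq_to_K] at h2
  have h3 : ‖A x‖ ^ 2 = c * ‖x‖ ^ 2 := Complex.ofReal_injective (by push_cast; exact h2)
  refine le_of_sq_le_sq ?_ (by positivity)
  rw [h3]
  nlinarith [sq_nonneg ‖x‖]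

/-- Two projective tests `P` and `Q` along a chain of registers. The projections `b j` and `a j`
test whether a register is in the state held by the left end of the chain. -/
theorem norm_apply_apply_le_of_chain {P Q : H →L[ℂ] H} (hP : IsStarProjection P)
    (hQ : IsStarProjection Q) {r : ℕ} (hr : 1 ≤ r) (a b U W : ℕ → H →L[ℂ] H)
    (ha : ∀ j, IsStarProjection (a j))
    (hU : ∀ j < r, ∀ x, ‖U j x‖ = ‖x‖) (hW : ∀ j, 1 ≤ j → j < r → ∀ x, ‖W j x‖ = ‖x‖)
    (hUQ : ∀ j < r, U j * Q = Q) (hWP : ∀ j, 1 ≤ j → j < r → W j * P = P)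
    (haU : ∀ j < r, a (j + 1) * U j = U j * b j)
    (hbW : ∀ j, 1 ≤ j → j < r → b j * W j = W j * a j)
    (hb0 : b 0 * P = P) (har : ∀ x, ‖a r (P x)‖ ≤ 1 / 2 * ‖P x‖) (x : H) :
    ‖Q (P x)‖ ^ 2 ≤ (1 - 1 / (16 * (r : ℝ) ^ 2)) * ‖x‖ ^ 2 := by
  have happ (A B : H →L[ℂ] H) (y : H) : (A * B) y = A (B y) := rfl
  obtain ⟨ζ, hζ⟩ : ∃ ζ, ζ = P x := ⟨_, rfl⟩
  rw [← hζ]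
  set ε := ‖ζ - Q ζ‖ with hε
  -- Crossing an edge: `U j` fixes `Q ζ`, so it moves `ζ` by at most `2ε`, and it carries the test
  -- `b j` to `a (j + 1)`.
  have hedge : ∀ j < r, ‖b j ζ‖ ≤ ‖a (j + 1) ζ‖ + 2 * ε := fun j hj => by
    have h1 : ‖U j ζ - ζ‖ ≤ 2 * ε := by
      have h2 : U j ζ - ζ = U j (ζ - Q ζ) - (ζ - Q ζ) := by
        have : U j (Q ζ) = Q ζ := by rw [← happ, hUQ j hj]
        rw [map_sub, this]
        abel
      rw [h2]
      refine (norm_sub_le _ _).trans ?_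
      rw [hU j hj]
      linarith
    have h3 : ‖b j ζ‖ = ‖a (j + 1) (U j ζ)‖ := by
      rw [← happ, haU j hj, happ, hU j hj]
    have h4 : a (j + 1) (U j ζ) = a (j + 1) ζ + a (j + 1) (U j ζ - ζ) := by
      rw [map_sub]
      abel
    rw [h3, h4]
    exact (norm_add_le _ _).trans
      (add_le_add_right (((ha _).norm_apply_le _).trans h1) _)
  -- Crossing a node costs nothing, as `W j` fixes `ζ = P x` exactly.
  have hnode : ∀ j, 1 ≤ j → j < r → ‖a j ζ‖ = ‖b j ζ‖ := fun j h1 h2 => by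
    have h3 : W j ζ = ζ := by rw [hζ, ← happ, hWP j h1 h2]
    rw [← hW j h1 h2, ← happ, ← hbW j h1 h2,
      happ, h3]
  have hchain : ∀ j < r, ‖ζ‖ ≤ ‖a (j + 1) ζ‖ + 2 * (j + 1 : ℕ) * ε := fun j => by
    induction j with
    | zero =>
      intro h
      have h0 : b 0 ζ = ζ := by rw [hζ, ← happ, hb0]
      have := hedge 0 h
      rw [h0] at this
      simpa using this
    | succ j ih =>
      intro h
      have h1 := ih (by omega)
      rw [hnode (j + 1) (by omega) h] at h1
      have h2 := hedge (j + 1) h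
      push_cast at h1 ⊢
      linarith
  obtain ⟨j, rfl⟩ : ∃ j, r = j + 1 := ⟨r - 1, by omega⟩
  have h1 := hchain j (by omega)
  have h2 := har x
  rw [← hζ] at h2
  -- The chain gives `‖ζ‖ ≤ ‖a r ζ‖ + 2rε`, and the last test absorbs half of `‖ζ‖`.
  have h3 : ‖ζ‖ ≤ 4 * ((j + 1 : ℕ) : ℝ) * ε := by linarith
  have hpos : (0 : ℝ) < ((j + 1 : ℕ) : ℝ) := by positivity
  set R : ℝ := ((j + 1 : ℕ) : ℝ)
  have h4 : ‖ζ‖ ^ 2 ≤ 16 * R ^ 2 * ε ^ 2 := by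
    calc ‖ζ‖ ^ 2 ≤ (4 * R * ε) ^ 2 := pow_le_pow_left₀ (norm_nonneg _) h3 2
      _ = _ := by ring
  have h5 : 1 / (16 * R ^ 2) * ‖ζ‖ ^ 2 ≤ ε ^ 2 := by
    rw [div_mul_eq_mul_div, one_mul, div_le_iff₀ (by positivity)]
    linarith
  have h6 := hQ.norm_sq_add ζ
  have h7 : ‖Q ζ‖ ^ 2 ≤ (1 - 1 / (16 * R ^ 2)) * ‖ζ‖ ^ 2 := by linarith
  refine h7.trans (mul_le_mul_of_nonneg_left
    (pow_le_pow_left₀ (norm_nonneg _) (hζ ▸ hP.norm_apply_le x) 2) ?_)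
  have hR1 : (1 : ℝ) ≤ R := by simp [R]
  rw [sub_nonneg, div_le_one (by positivity)]
  nlinarith

end Chain

/-! ### Operators on single registers, permutations of registers, the symmetric subspace -/

/-- The projection `|ψ⟩⟨ψ|` for a unit vector `ψ`. -/
def ketBra {X : Type} (ψ : X → ℂ) : Matrix X X ℂ := Matrix.vecMulVec ψ (star ψ)

/-- The operator `K` acting on the register at site `p`. -/
def siteOp {S X : Type} [Fintype S] [DecidableEq S] [DecidableEq X] (p : S)
    (K : Matrix X X ℂ) : Matrix (S → X) (S → X) ℂ :=
  tensorAll fun q => if q = p then K else 1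

/-- The operator permuting registers by `σ`. -/
def permOp {S X : Type} [Fintype S] [DecidableEq X] (σ : Equiv.Perm S) :
    Matrix (S → X) (S → X) ℂ :=
  fun s t => if s ∘ σ = t then 1 else 0

section SiteOp

theorem siteOp_smul {S X : Type} [Fintype S] [DecidableEq S] [DecidableEq X] (p : S)
    (c : ℂ) (K : Matrix X X ℂ) : siteOp p (c • K) = c • siteOp p K := by
  ext s t
  have h : ∀ q, (if q = p then c • K else 1 : Matrix X X ℂ) (s q) (t q) =
      (if q = p then c else 1) * (if q = p then K else 1 : Matrix X X ℂ) (s q) (t q) := fun q => by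
    split_ifs <;> simp
  simp only [siteOp, tensorAll, h, Finset.prod_mul_distrib, Matrix.smul_apply, smul_eq_mul,
    Finset.prod_ite_eq', Finset.mem_univ, if_true]

variable {S X : Type} [Fintype S] [Fintype X]

/-- The relation `B A B = c B` required by `IsStarProjection.norm_apply_le_half`; here the
fingerprint overlap enters. -/
theorem ketBra_mul_ketBra_mul_ketBra (ψ φ : X → ℂ) :
    ketBra ψ * ketBra φ * ketBra ψ = ((Complex.normSq (star ψ ⬝ᵥ φ) : ℝ) : ℂ) • ketBra ψ := by
  have h : star φ ⬝ᵥ ψ = star (star ψ ⬝ᵥ φ) := by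
    rw [Matrix.star_dotProduct]
  simp only [ketBra, Matrix.vecMulVec_mul_vecMulVec, Matrix.vecMulVec_smul, Matrix.smul_mul, h,
    smul_smul]
  rw [Complex.normSq_eq_conj_mul_self, mul_comm]
  rfl

theorem ketBra_mulVec {ψ : X → ℂ} (hψ : star ψ ⬝ᵥ ψ = 1) : ketBra ψ *ᵥ ψ = ψ := by
  rw [ketBra, Matrix.vecMulVec_mulVec, hψ]
  simp

theorem isStarProjection_ketBra {ψ : X → ℂ} (hψ : star ψ ⬝ᵥ ψ = 1) :
    IsStarProjection (ketBra ψ) where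
  isIdempotentElem := by
    rw [IsIdempotentElem, ketBra, Matrix.vecMulVec_mul_vecMulVec, hψ, one_smul]
  isSelfAdjoint := by
    rw [IsSelfAdjoint, Matrix.star_eq_conjTranspose, ketBra, Matrix.conjTranspose_vecMulVec,
      star_star]

theorem star_dotProduct_self_eq_norm_sq (x : EuclideanSpace ℂ S) :
    star x.ofLp ⬝ᵥ x.ofLp = ((‖x‖ ^ 2 : ℝ) : ℂ) := by
  rw [EuclideanSpace.norm_sq_eq, dotProduct]
  push_cast
  exact Finset.sum_congr rfl fun i _ => Complex.conj_mul' (x i)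

variable [DecidableEq S] [DecidableEq X]

theorem siteOp_mul (p : S) (K L : Matrix X X ℂ) :
    siteOp p K * siteOp p L = siteOp p (K * L) := by
  rw [siteOp, siteOp, siteOp, tensorAll_mul]
  congr 1
  funext q
  split_ifs <;> simp

theorem isStarProjection_siteOp (p : S) {K : Matrix X X ℂ} (hK : IsStarProjection K) :
    IsStarProjection (siteOp p K) :=
  IsStarProjection.tensorAll fun q => by
    split_ifs
    exacts [hK, .one _]

theorem siteOp_mulVec_prod (p : S) {K : Matrix X X ℂ} {ψ : X → ℂ} (h : K *ᵥ ψ = ψ) :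
    siteOp p K *ᵥ (fun s => ∏ q, ψ (s q)) = fun s => ∏ q, ψ (s q) := by
  rw [siteOp, tensorAll_mulVec_prod _ fun _ => ψ]
  funext s
  refine Finset.prod_congr rfl fun q _ => ?_
  split_ifs <;> simp [h]

theorem permOp_mul (σ : Equiv.Perm S) (M : Matrix (S → X) (S → X) ℂ) :
    permOp σ * M = M.submatrix (fun s => s ∘ σ) id := by
  ext s t
  simp [Matrix.mul_apply, permOp]

theorem permOp_mulVec (σ : Equiv.Perm S) (x : (S → X) → ℂ) :
    permOp σ *ᵥ x = fun s => x (s ∘ σ) := by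
  ext s
  simp [Matrix.mulVec, dotProduct, permOp]

theorem siteOp_mul_permOp (σ : Equiv.Perm S) (p : S) (K : Matrix X X ℂ) :
    siteOp (σ p) K * permOp σ = permOp σ * siteOp p K := by
  rw [permOp_mul]
  ext s t
  have h : ∀ u : S → X, (u ∘ σ = t) = (t ∘ σ.symm = u) := fun u => by
    rw [eq_iff_iff, Equiv.comp_symm_eq, eq_comm]
  simp only [Matrix.mul_apply, permOp, h, mul_ite, mul_one, mul_zero, Finset.sum_ite_eq,
    Finset.mem_univ, if_true, Matrix.submatrix_apply, id_eq]
  simp only [siteOp, tensorAll]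
  rw [← Equiv.prod_comp σ]
  refine Finset.prod_congr rfl fun q _ => ?_
  simp

/-- The projection onto the symmetric subspace of two registers. -/
noncomputable def symProj (X : Type) [DecidableEq X] : Matrix (Bool → X) (Bool → X) ℂ :=
  (1 / 2 : ℂ) • (1 + permOp Equiv.boolNot)

theorem permOp_boolNot_mul_self :
    (permOp Equiv.boolNot : Matrix (Bool → X) (Bool → X) ℂ) * permOp Equiv.boolNot = 1 := by
  rw [permOp_mul]
  ext s t
  have : (s ∘ Equiv.boolNot) ∘ Equiv.boolNot = s := by
    funext i
    simp
  simp only [Matrix.submatrix_apply, id_eq, permOp, this, Matrix.one_apply]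

theorem isStarProjection_symProj : IsStarProjection (symProj X) where
  isIdempotentElem := by
    rw [IsIdempotentElem, symProj, Matrix.smul_mul, Matrix.mul_smul, mul_add, mul_one, add_mul,
      permOp_boolNot_mul_self, one_mul, smul_smul]
    module
  isSelfAdjoint := by
    rw [IsSelfAdjoint, Matrix.star_eq_conjTranspose, symProj, Matrix.conjTranspose_smul,
      Matrix.conjTranspose_add, Matrix.conjTranspose_one]
    have : (permOp Equiv.boolNot : Matrix (Bool → X) (Bool → X) ℂ)ᴴ = permOp Equiv.boolNot := by
      ext s t
      have h : (t ∘ Equiv.boolNot = s) = (s ∘ Equiv.boolNot = t) := by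
        rw [eq_iff_iff]
        constructor <;>
        · rintro rfl
          funext i
          simp
      simp only [Matrix.conjTranspose_apply, permOp, h]
      split_ifs <;> simp
    rw [this]
    simp

/-- The entrywise form of the fact that the swap acts trivially on the symmetric subspace. -/
theorem symProj_swap (u w : Bool → X) : symProj X (fun i => u (!i)) w = symProj X u w := by
  have h := permOp_mul Equiv.boolNot (symProj X)
  rw [symProj, Matrix.mul_smul, mul_add, mul_one, permOp_boolNot_mul_self, add_comm,
    ← symProj] at h
  exact (congrFun (congrFun h u) w).symm

theorem symProj_mulVec_prod (ψ : X → ℂ) :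
    symProj X *ᵥ (fun u => ∏ i, ψ (u i)) = fun u => ∏ i, ψ (u i) := by
  rw [symProj, Matrix.smul_mulVec, Matrix.add_mulVec, Matrix.one_mulVec, permOp_mulVec]
  funext u
  simp only [Pi.smul_apply, Pi.add_apply, smul_eq_mul, Function.comp_apply]
  rw [Equiv.prod_comp Equiv.boolNot fun i => ψ (u i)]
  ring

theorem norm_toEuclideanCLM_permOp (σ : Equiv.Perm S) (x : EuclideanSpace ℂ (S → X)) :
    ‖Matrix.toEuclideanCLM (𝕜 := ℂ) (permOp σ) x‖ = ‖x‖ := by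
  rw [EuclideanSpace.norm_eq, EuclideanSpace.norm_eq, Matrix.ofLp_toEuclideanCLM, permOp_mulVec]
  congr 1
  exact Equiv.sum_comp (Equiv.arrowCongr σ.symm (Equiv.refl X)) fun s => ‖x s‖ ^ 2

/-- Turns the norm estimate on vectors into an operator inequality, the form that passes to tensor
powers and mixed states. -/
theorem posSemidef_smul_one_sub_of_norm_sq_le {c : ℝ} {A : Matrix S S ℂ}
    (h : ∀ x, ‖Matrix.toEuclideanCLM (𝕜 := ℂ) A x‖ ^ 2 ≤ c * ‖x‖ ^ 2) :
    ((c : ℂ) • 1 - Aᴴ * A).PosSemidef := by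
  refine .of_dotProduct_mulVec_nonneg ?_ fun x => ?_
  · rw [Matrix.IsHermitian, Matrix.conjTranspose_sub, Matrix.conjTranspose_smul,
      Matrix.conjTranspose_mul, Matrix.conjTranspose_conjTranspose, Matrix.conjTranspose_one]
    simp
  · have h1 := star_dotProduct_self_eq_norm_sq (WithLp.toLp 2 x)
    have h2 := star_dotProduct_self_eq_norm_sq
      (Matrix.toEuclideanCLM (𝕜 := ℂ) A (WithLp.toLp 2 x))
    rw [Matrix.ofLp_toEuclideanCLM, Matrix.star_mulVec, ← Matrix.dotProduct_mulVec,
      Matrix.mulVec_mulVec] at h2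
    rw [Matrix.sub_mulVec, Matrix.smul_mulVec, Matrix.one_mulVec, dotProduct_sub,
      dotProduct_smul, h1, h2, sub_nonneg, smul_eq_mul]
    exact_mod_cast h _

end SiteOp

/-! ### Simultaneous tests on disjoint pairs of registers -/

/-- Regroups the registers in pairs, the pair of `v` being the registers at `π (v, false)` and
`π (v, true)`. -/
def pairEquiv {V : Type} (X : Type) (π : Equiv.Perm (V × Bool)) :
    (V × Bool → X) ≃ (V → Bool → X) where
  toFun s v i := s (π (v, i))
  invFun u p := u (π.symm p).1 (π.symm p).2
  left_inv s := by
    funext p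
    simp
  right_inv u := by
    funext v i
    simp

/-- The joint operator applying `T v` to the registers at `π (v, false)` and `π (v, true)`. -/
def pairOp {V X : Type} [Fintype V] (π : Equiv.Perm (V × Bool))
    (T : V → Matrix (Bool → X) (Bool → X) ℂ) : Matrix (V × Bool → X) (V × Bool → X) ℂ :=
  (tensorAll T).submatrix (pairEquiv X π) (pairEquiv X π)

section PairOp

variable {V X : Type} [Fintype V] [DecidableEq V]

/-- Written as a pair operator, a one-register test can be multiplied with the node tests factor by
factor. -/
theorem siteOp_eq_pairOp [DecidableEq X] (v : V) (i : Bool) (K : Matrix X X ℂ) :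
    siteOp (v, i) K = pairOp 1 fun w => if w = v then siteOp i K else 1 := by
  ext s t
  simp only [siteOp, pairOp, tensorAll, Matrix.submatrix_apply, Fintype.prod_prod_type]
  refine Finset.prod_congr rfl fun w _ => ?_
  by_cases hw : w = v
  · simp [hw, pairEquiv, tensorAll]
  · simp only [Prod.mk.injEq, hw, false_and, if_false]
    rw [← tensorAll_one]
    rfl

variable [Fintype X] (π : Equiv.Perm (V × Bool))

theorem isStarProjection_pairOp {T : V → Matrix (Bool → X) (Bool → X) ℂ}
    (hT : ∀ v, IsStarProjection (T v)) : IsStarProjection (pairOp π T) :=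
  (IsStarProjection.tensorAll hT).submatrix_equiv _

theorem pairOp_mulVec_prod {T : V → Matrix (Bool → X) (Bool → X) ℂ} {ψ : X → ℂ}
    (h : ∀ v, T v *ᵥ (fun u => ∏ i, ψ (u i)) = fun u => ∏ i, ψ (u i)) :
    pairOp π T *ᵥ (fun s => ∏ p, ψ (s p)) = fun s => ∏ p, ψ (s p) := by
  have h1 : ∀ s : V × Bool → X,
      ∏ p, ψ (s p) = ∏ v, ∏ i, ψ (pairEquiv X π s v i) := fun s => by
    rw [← Equiv.prod_comp π, Fintype.prod_prod_type]
    rfl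
  have h2 := tensorAll_mulVec_prod T fun _ u => ∏ i, ψ (u i)
  simp only [h] at h2
  rw [pairOp, Matrix.submatrix_mulVec_equiv]
  funext s
  refine (congrArg (fun f => (tensorAll T *ᵥ f) (pairEquiv X π s)) ?_).trans
    ((congrFun h2 _).trans (h1 s).symm)
  funext u
  simp only [Function.comp_apply, h1, Equiv.apply_symm_apply]

variable [DecidableEq X]

/-- Swapping the two registers of one pair affects only the factor `T v`, whose range is
swap-invariant by `h`. -/
theorem permOp_swap_mul_pairOp {T : V → Matrix (Bool → X) (Bool → X) ℂ} {v : V}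
    (h : ∀ u w, T v (fun i => u (!i)) w = T v u w) :
    permOp (Equiv.swap (π (v, false)) (π (v, true))) * pairOp π T = pairOp π T := by
  rw [permOp_mul]
  ext s t
  simp only [pairOp, Matrix.submatrix_apply, id_eq, tensorAll]
  refine Finset.prod_congr rfl fun w _ => ?_
  by_cases hw : w = v
  · subst hw
    rw [← h (pairEquiv X π s w)]
    congr 1
    funext i
    cases i <;> simp [pairEquiv]
  · congr 1
    funext i
    simp only [pairEquiv, Equiv.coe_fn_mk, Function.comp_apply]
    rw [Equiv.swap_apply_of_ne_of_ne] <;>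
    · rw [Ne, π.apply_eq_iff_eq, Prod.mk.injEq]
      exact fun h => hw h.1

theorem siteOp_mul_pairOp {T : V → Matrix (Bool → X) (Bool → X) ℂ} {v : V} {i : Bool}
    {K : Matrix X X ℂ} (h : siteOp i K * T v = T v) :
    siteOp (v, i) K * pairOp 1 T = pairOp 1 T := by
  rw [siteOp_eq_pairOp, pairOp, pairOp, Matrix.submatrix_mul_equiv, tensorAll_mul]
  congr 2
  funext w
  split_ifs with hw
  · rw [hw, h]
  · rw [one_mul]

end PairOp

/-! ### One copy of the test on the path -/

section Path

variable {r : ℕ} {X : Type} [Fintype X] [DecidableEq X]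

/-- The pairing of the registers after the communication round: node `v` holds its register
`(v, false)` and the register `(v - 1, true)` of its left neighbour. The right register of the
last node is listed at node `0`. -/
def shiftPerm (r : ℕ) : Equiv.Perm (Fin (r + 1) × Bool) where
  toFun p := if p.2 then (p.1 - 1, true) else p
  invFun p := if p.2 then (p.1 + 1, true) else p
  left_inv := by
    rintro ⟨v, _ | _⟩ <;> simp
  right_inv := by
    rintro ⟨v, _ | _⟩ <;> simp

/-- The test of node `v` before the communication round. The ends compare a register with the
state that they hold, the other nodes test the symmetry of their two registers. -/
noncomputable def nodeTest (α : Fin (r + 1) → X → ℂ) (v : Fin (r + 1)) :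
    Matrix (Bool → X) (Bool → X) ℂ :=
  if v = 0 then siteOp true (ketBra (α v))
  else if v = Fin.last r then siteOp false (ketBra (α v)) else symProj X

/-- The test of node `v` on its left register and on the register received from the left. -/
noncomputable def edgeTest (X : Type) [DecidableEq X] (v : Fin (r + 1)) :
    Matrix (Bool → X) (Bool → X) ℂ :=
  if v = 0 then 1 else symProj X

/-- The operator whose expectation is the acceptance probability of one copy of the test. -/
noncomputable def copyAccept (α : Fin (r + 1) → X → ℂ) :
    Matrix (Fin (r + 1) × Bool → X) (Fin (r + 1) × Bool → X) ℂ :=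
  pairOp 1 (nodeTest α) * pairOp (shiftPerm r) (edgeTest X) * pairOp 1 (nodeTest α)

theorem isStarProjection_nodeTest {α : Fin (r + 1) → X → ℂ} (hα : ∀ v, star (α v) ⬝ᵥ α v = 1)
    (v : Fin (r + 1)) : IsStarProjection (nodeTest α v) := by
  unfold nodeTest
  split_ifs
  exacts [isStarProjection_siteOp _ (isStarProjection_ketBra (hα v)),
    isStarProjection_siteOp _ (isStarProjection_ketBra (hα v)), isStarProjection_symProj]

theorem isStarProjection_edgeTest (v : Fin (r + 1)) : IsStarProjection (edgeTest X v) := by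
  unfold edgeTest
  split_ifs
  exacts [.one _, isStarProjection_symProj]

theorem copyAccept_mulVec_prod {α : Fin (r + 1) → X → ℂ} {ψ : X → ℂ} (hψ : star ψ ⬝ᵥ ψ = 1)
    (h0 : α 0 = ψ) (hr : α (Fin.last r) = ψ) :
    copyAccept α *ᵥ (fun s => ∏ p, ψ (s p)) = fun s => ∏ p, ψ (s p) := by
  have h1 : pairOp 1 (nodeTest α) *ᵥ (fun s => ∏ p, ψ (s p)) = fun s => ∏ p, ψ (s p) := by
    refine pairOp_mulVec_prod _ fun v => ?_
    unfold nodeTest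
    split_ifs with h h
    · rw [h, h0, siteOp_mulVec_prod _ (ketBra_mulVec hψ)]
    · rw [h, hr, siteOp_mulVec_prod _ (ketBra_mulVec hψ)]
    · exact symProj_mulVec_prod ψ
  have h2 : pairOp (shiftPerm r) (edgeTest X) *ᵥ (fun s => ∏ p, ψ (s p)) =
      fun s => ∏ p, ψ (s p) := by
    refine pairOp_mulVec_prod _ fun v => ?_
    unfold edgeTest
    split_ifs
    · exact Matrix.one_mulVec _
    · exact symProj_mulVec_prod ψ
  rw [copyAccept, ← Matrix.mulVec_mulVec, ← Matrix.mulVec_mulVec, h1, h2, h1]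

/-- As the second test is idempotent, the expectation of `copyAccept α` is a squared norm `‖Q P
x‖²`. -/
theorem copyAccept_eq {α : Fin (r + 1) → X → ℂ} (hα : ∀ v, star (α v) ⬝ᵥ α v = 1) :
    copyAccept α = (pairOp (shiftPerm r) (edgeTest X) * pairOp 1 (nodeTest α))ᴴ *
      (pairOp (shiftPerm r) (edgeTest X) * pairOp 1 (nodeTest α)) := by
  have hP := isStarProjection_pairOp 1 (isStarProjection_nodeTest hα)
  have hQ := isStarProjection_pairOp (shiftPerm r) (isStarProjection_edgeTest (X := X))
  rw [Matrix.conjTranspose_mul, ← Matrix.star_eq_conjTranspose, ← Matrix.star_eq_conjTranspose,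
    hP.isSelfAdjoint.star_eq, hQ.isSelfAdjoint.star_eq, copyAccept, Matrix.mul_assoc,
    Matrix.mul_assoc, ← Matrix.mul_assoc (pairOp (shiftPerm r) (edgeTest X)),
    hQ.isIdempotentElem.eq]

theorem posSemidef_copyAccept {α : Fin (r + 1) → X → ℂ} (hα : ∀ v, star (α v) ⬝ᵥ α v = 1) :
    (copyAccept α).PosSemidef := by
  rw [copyAccept_eq hα]
  exact Matrix.posSemidef_conjTranspose_mul_self _

/-- The chain estimate applied to the registers along the path, with the fingerprint `α 0` as the
state followed from left to right. -/
theorem posSemidef_smul_one_sub_copyAccept {α : Fin (r + 1) → X → ℂ} (hr : 1 ≤ r)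
    (hα : ∀ v, star (α v) ⬝ᵥ α v = 1)
    (h : Complex.normSq (star (α (Fin.last r)) ⬝ᵥ α 0) ≤ 1 / 4) :
    (((1 - 1 / (16 * (r : ℝ) ^ 2) : ℝ) : ℂ) • 1 - copyAccept α).PosSemidef := by
  have hP := isStarProjection_pairOp 1 (isStarProjection_nodeTest hα)
  have hQ := isStarProjection_pairOp (shiftPerm r) (isStarProjection_edgeTest (X := X))
  have hlast : Fin.last r ≠ 0 := by
    rw [Ne, Fin.ext_iff]
    simp
    omega
  set K := ketBra (α 0) with hK
  have hKp : IsStarProjection K := isStarProjection_ketBra (hα 0)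
  set E := Matrix.toEuclideanCLM (n := Fin (r + 1) × Bool → X) (𝕜 := ℂ)
  -- Nodes are indexed by naturals up to `r`, a range in which `Fin.ofNat` does not wrap around.
  have hval : ∀ j, j < r + 1 → ((Fin.ofNat (r + 1) j : Fin (r + 1)) : ℕ) = j := fun j hj =>
    Nat.mod_eq_of_lt hj
  have hsub : ∀ j < r, Fin.ofNat (r + 1) (j + 1) - 1 = Fin.ofNat (r + 1) j := fun j hj => by
    rw [sub_eq_iff_eq_add]
    ext
    rw [Fin.val_add_one_of_lt, hval _ (by omega), hval _ (by omega)]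
    rw [Fin.lt_def, hval _ (by omega)]
    exact hj
  have hne0 : ∀ j, 1 ≤ j → j < r + 1 → Fin.ofNat (r + 1) j ≠ 0 := fun j h1 h2 h => by
    have := congrArg Fin.val h
    rw [hval _ h2] at this
    simp at this
    omega
  have hE : ∀ A B, E A * E B = E (A * B) := fun A B => (map_mul E A B).symm
  rw [copyAccept_eq hα]
  refine posSemidef_smul_one_sub_of_norm_sq_le fun x => ?_
  have hfin : Fin.ofNat (r + 1) r = Fin.last r := by
    ext
    rw [hval _ (by omega), Fin.val_last]
  -- `a j` and `b j` test the left and right registers of node `j`; `U j` swaps the two registers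
  -- meeting on the edge from `j` to `j + 1`, and `W j` the two registers of node `j`.
  have key := norm_apply_apply_le_of_chain (hP.map E) (hQ.map E) hr
    (fun j => E (siteOp (Fin.ofNat (r + 1) j, false) K))
    (fun j => E (siteOp (Fin.ofNat (r + 1) j, true) K))
    (fun j => E (permOp (Equiv.swap (Fin.ofNat (r + 1) (j + 1), false)
      (Fin.ofNat (r + 1) j, true))))
    (fun j => E (permOp (Equiv.swap (Fin.ofNat (r + 1) j, false) (Fin.ofNat (r + 1) j, true))))
    (fun j => (isStarProjection_siteOp _ hKp).map E)
    (fun j _ x => norm_toEuclideanCLM_permOp _ x)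
    (fun j _ _ x => norm_toEuclideanCLM_permOp _ x)
    (fun j hj => ?_) (fun j h1 h2 => ?_) (fun j hj => ?_) (fun j h1 h2 => ?_) ?_ (fun x => ?_) x
  · rw [map_mul]
    exact key
  · have := permOp_swap_mul_pairOp (shiftPerm r) (T := edgeTest X)
      (v := Fin.ofNat (r + 1) (j + 1)) fun u w => by
        rw [edgeTest, if_neg (hne0 _ (by omega) (by omega))]
        exact symProj_swap u w
    simp only [shiftPerm, Equiv.coe_fn_mk, Bool.false_eq_true, if_false, if_true, hsub j hj] at this
    rw [hE]
    exact congrArg E this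
  · have := permOp_swap_mul_pairOp 1 (T := nodeTest α) (v := Fin.ofNat (r + 1) j) fun u w => by
      rw [nodeTest, if_neg (hne0 _ h1 (by omega)), if_neg]
      · exact symProj_swap u w
      · rw [Fin.ext_iff, hval _ (by omega), Fin.val_last]
        omega
    rw [hE]
    exact congrArg E this
  · rw [hE, hE]
    have := siteOp_mul_permOp (Equiv.swap (Fin.ofNat (r + 1) (j + 1), false)
      (Fin.ofNat (r + 1) j, true)) (Fin.ofNat (r + 1) j, true) K
    rw [Equiv.swap_apply_right] at this
    exact congrArg E this
  · rw [hE, hE]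
    have := siteOp_mul_permOp (Equiv.swap (Fin.ofNat (r + 1) j, false)
      (Fin.ofNat (r + 1) j, true)) (Fin.ofNat (r + 1) j, false) K
    rw [Equiv.swap_apply_left] at this
    exact congrArg E this
  · rw [hE]
    refine congrArg E ?_
    refine siteOp_mul_pairOp ?_
    have h0 : Fin.ofNat (r + 1) 0 = 0 := rfl
    rw [h0, nodeTest, if_pos rfl, siteOp_mul, hKp.isIdempotentElem.eq]
  · have hK' := isStarProjection_ketBra (hα (Fin.last r))
    have h3 : siteOp (Fin.last r, false) (ketBra (α (Fin.last r))) * pairOp 1 (nodeTest α) =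
        pairOp 1 (nodeTest α) := by
      refine siteOp_mul_pairOp ?_
      rw [nodeTest, if_neg hlast, if_pos rfl, siteOp_mul, hK'.isIdempotentElem.eq]
    refine IsStarProjection.norm_apply_le_half ((isStarProjection_siteOp _ hKp).map E)
      ((isStarProjection_siteOp (Fin.last r, false) hK').map E) h ?_ ?_
    · rw [hfin, hE, hE, siteOp_mul, siteOp_mul, hK, ketBra_mul_ketBra_mul_ketBra,
        siteOp_smul, map_smul]
    · exact DFunLike.congr_fun ((hE _ _).trans (congrArg E h3)) x

end Path

/-! ### Acceptance probability in the Heisenberg picture -/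

section Trace

variable {A B : Type} [Fintype A]

/-- Cyclicity of the trace moves the Kraus operator and the delivery of messages from the state to
the measurement. -/
theorem trace_mul_reindex_kraus {C : Type} [Fintype B] [Fintype C] (T : Matrix B B ℂ) (G : Matrix A C ℂ)
    (ρ : Matrix C C ℂ) (e : A ≃ B) :
    (T * (G * ρ * Gᴴ).reindex e e).trace = (Gᴴ * T.submatrix e e * G * ρ).trace := by
  have h : T * (G * ρ * Gᴴ).reindex e e =
      (T.submatrix e e * (G * ρ * Gᴴ)).reindex e e := by
    rw [Matrix.reindex_apply, Matrix.reindex_apply, ← Matrix.submatrix_mul_equiv _ _ _ e.symm]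
    simp
  have h' : ∀ M : Matrix A A ℂ, (M.reindex e e).trace = M.trace := fun M =>
    Equiv.sum_comp e.symm fun a => M a a
  rw [h, h', ← Matrix.mul_assoc, Matrix.trace_mul_comm]
  simp only [Matrix.mul_assoc]

/-- The operator mapping the basis state `a` to the basis state `f a`. -/
def basisMap {A B : Type} [DecidableEq B] (f : A → B) : Matrix B A ℂ :=
  fun b a => if b = f a then 1 else 0

theorem conjTranspose_basisMap_mul_mul [DecidableEq A] (T : Matrix A A ℂ) (f : B → A) :
    (basisMap f)ᴴ * T * basisMap f = T.submatrix f f := by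
  ext b b'
  simp [Matrix.mul_apply, basisMap]

theorem conjTranspose_basisMap_mul_self [DecidableEq A] [DecidableEq B] {f : B → A}
    (hf : Function.Injective f) : (basisMap f)ᴴ * basisMap f = 1 := by
  have := conjTranspose_basisMap_mul_mul 1 f
  rwa [Matrix.mul_one, Matrix.submatrix_one f hf] at this

theorem tensorAll_basisMap {V : Type} [Fintype V] [DecidableEq V] {A B : V → Type}
    [∀ v, DecidableEq (B v)] (f : ∀ v, A v → B v) :
    tensorAll (fun v => basisMap (f v)) = basisMap fun s v => f v (s v) := by
  ext b a
  by_cases h : b = fun v => f v (a v)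
  · subst h
    simp [tensorAll, basisMap]
  · obtain ⟨v, hv⟩ := Function.ne_iff.mp h
    rw [basisMap, if_neg h]
    exact Finset.prod_eq_zero (Finset.mem_univ v) (if_neg hv)

theorem DQMAProtocol.acceptProb_eq_sum {V : Type} [Fintype V] [DecidableEq V]
    {G : SimpleGraph V} {n : ℕ} (P : DQMAProtocol G n) (inp : V → Option (BitString n))
    (ρ : Matrix P.Certs P.Certs ℂ) :
    P.acceptProb inp ρ = (∑ i, ((P.globalKraus inp i)ᴴ *
      (tensorAll fun v => P.accept v (inp v)).submatrix P.deliver P.deliver *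
        P.globalKraus inp i * ρ).trace).re := by
  simp only [← trace_mul_reindex_kraus]
  rw [DQMAProtocol.acceptProb, DQMAProtocol.sentState, ← Matrix.trace_sum, ← Matrix.mul_sum]
  congr 3
  ext s t
  simp [Matrix.sum_apply]

/-- Meant for protocols whose sending step records a test outcome: only the branch in which every
node records success can be accepted. -/
theorem DQMAProtocol.acceptProb_eq_of_single {V : Type} [Fintype V] [DecidableEq V]
    {G : SimpleGraph V} {n : ℕ} (P : DQMAProtocol G n) (inp : V → Option (BitString n))
    {D : Type} [Fintype D] (e : P.Certs ≃ D) (M : Matrix D D ℂ)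
    (i₀ : ∀ v, (P.send v (inp v)).Idx)
    (h : (P.globalKraus inp i₀)ᴴ *
      (tensorAll fun v => P.accept v (inp v)).submatrix P.deliver P.deliver *
        P.globalKraus inp i₀ = M.submatrix e e)
    (h' : ∀ i ≠ i₀, (P.globalKraus inp i)ᴴ *
      (tensorAll fun v => P.accept v (inp v)).submatrix P.deliver P.deliver *
        P.globalKraus inp i = 0)
    (ρ : Matrix P.Certs P.Certs ℂ) :
    P.acceptProb inp ρ = (M * ρ.submatrix e.symm e.symm).trace.re := by
  rw [DQMAProtocol.acceptProb_eq_sum, Fintype.sum_eq_single i₀ fun i hi => by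
    rw [h' i hi, Matrix.zero_mul, Matrix.trace_zero], h]
  congr 1
  have h3 := Matrix.submatrix_mul_equiv (M.submatrix e e) ρ e.symm e.symm e.symm
  rw [Matrix.submatrix_submatrix, Equiv.self_comp_symm, Matrix.submatrix_id_id] at h3
  rw [h3]
  exact (Equiv.sum_comp e.symm fun a => (M.submatrix e e * ρ) a a).symm

end Trace

set_option synthInstance.maxSize 1000

/-! ### Registers, messages and local measurements -/

section Layout

variable {r : ℕ}

/-- The length of the message from `v` to `w`: `L` qubits are sent to the right neighbour. -/
def rightMsg (r L : ℕ) (v w : Fin (r + 1)) : ℕ := if v.val + 1 = w.val then L else 0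

theorem rightMsg_le (L : ℕ) (v w : Fin (r + 1)) : rightMsg r L v w ≤ L := by
  unfold rightMsg
  split_ifs <;> simp

theorem rightMsg_eq_zero (L : ℕ) (v w : Fin (r + 1))
    (h : ¬ (SimpleGraph.pathGraph (r + 1)).Adj v w) : rightMsg r L v w = 0 := by
  rw [SimpleGraph.pathGraph_adj] at h
  exact if_neg fun h' => h (Or.inl h')

theorem rightMsg_sub_one (L : ℕ) {v : Fin (r + 1)} (hv : v ≠ 0) :
    rightMsg r L (v - 1) v = L := by
  have hv' : v.val ≠ 0 := fun h => hv (Fin.ext h)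
  rw [rightMsg, if_pos]
  rw [Fin.val_sub_one_of_ne_zero hv]
  omega

theorem rightMsg_zero_right (L : ℕ) (v : Fin (r + 1)) : rightMsg r L v 0 = 0 :=
  if_neg (by simp)

theorem eq_sub_one_of_rightMsg_ne_zero {L : ℕ} {v w : Fin (r + 1)} (h : rightMsg r L w v ≠ 0) :
    w = v - 1 := by
  have h' : w.val + 1 = v.val := by
    by_contra h'
    exact h (if_neg h')
  have hv : v ≠ 0 := fun h0 => by simp [h0] at h'
  ext
  rw [Fin.val_sub_one_of_ne_zero hv]
  omega

/-- The bits received from the left neighbour. -/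
def incoming {L : ℕ} (v : Fin (r + 1)) (q : ∀ w, Qubits (rightMsg r L w v)) : Qubits L :=
  fun i => if h : i.val < rightMsg r L (v - 1) v then q (v - 1) ⟨i, h⟩ else false

/-- Messages from nodes other than the left neighbour have no qubits, so nothing is lost by ignoring
them. -/
theorem incoming_injective {L : ℕ} (v : Fin (r + 1)) :
    Function.Injective (incoming (L := L) v) := by
  intro q q' h
  funext w i
  obtain rfl := eq_sub_one_of_rightMsg_ne_zero (v := v) (w := w) (L := L) (by have := i.2; omega)
  have := congrFun h ⟨i, i.2.trans_le (rightMsg_le _ _ _)⟩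
  simpa [incoming] using this

/-- The messages sent by a node that passes `q` to its right neighbour. -/
def outgoing {L : ℕ} (v : Fin (r + 1)) (q : Qubits L) : ∀ w, Qubits (rightMsg r L v w) :=
  fun w i => q (Fin.castLE (rightMsg_le L v w) i)

theorem incoming_outgoing {L : ℕ} {v : Fin (r + 1)} (hv : v ≠ 0) (q : Fin (r + 1) → Qubits L) :
    incoming v (fun w => outgoing w (q w) v) = q (v - 1) := by
  funext i
  have h : i.val < rightMsg r L (v - 1) v := by
    rw [rightMsg_sub_one L hv]
    exact i.2
  rw [incoming, dif_pos h]
  rfl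

theorem incoming_zero {L : ℕ} (q : ∀ w, Qubits (rightMsg r L w 0)) :
    incoming 0 q = fun _ => false := by
  funext i
  rw [incoming, dif_neg]
  rw [rightMsg_zero_right]
  exact Nat.not_lt_zero _

variable {k m : ℕ}

/-- A certificate consists of `k` pairs of registers of `m` qubits. -/
noncomputable def certEquiv (k m : ℕ) : Qubits (k * (2 * m)) ≃ (Fin k → Bool → Qubits m) :=
  -- Any bijection of basis labels serves, since it amounts to a unitary change of basis inside the
  -- node.
  Fintype.equivOfCardEq (by simp [pow_mul, mul_comm, pow_right_comm])

/-- A message consists of `k` registers of `m` qubits. -/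
noncomputable def msgEquiv (k m : ℕ) : Qubits (k * m) ≃ (Fin k → Qubits m) :=
  Fintype.equivOfCardEq (by simp [pow_mul, pow_right_comm])

/-- The memory of a node: the result of its first test, its left registers, and, at the last node,
its right registers. -/
abbrev NodeMem (k m : ℕ) : Type := Bool × (Fin k → Qubits m) × (Fin k → Qubits m)

/-- What a node keeps and sends. -/
noncomputable def sendMap (k m : ℕ) (v : Fin (r + 1)) (b : Bool) (u : Fin k → Bool → Qubits m) :
    NodeMem k m × ∀ w, Qubits (rightMsg r (k * m) v w) :=
  -- The last node has no right neighbour and must keep its right registers for the map to be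
  -- injective; elsewhere this slot is constant.
  ((b, fun i => u i false, fun i => if v = Fin.last r then u i true else fun _ => false),
    outgoing v ((msgEquiv k m).symm fun i => u i true))

/-- Injectivity makes `basisMap (sendMap k m v b)` an isometry, hence the sending step trace
preserving. -/
theorem sendMap_injective (v : Fin (r + 1)) (b : Bool) :
    Function.Injective (sendMap k m v b) := by
  intro u u' h
  simp only [sendMap, Prod.mk.injEq, true_and] at h
  obtain ⟨⟨h1, h2⟩, h3⟩ := h
  have h4 : (fun i => u i true) = fun i => u' i true := by
    by_cases hv : v = Fin.last r
    · simpa [hv] using h2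
    -- Away from the last node the message to `v + 1` has full length, so it determines the right
    -- registers.
    · have hv' : v + 1 ≠ 0 := fun h0 => hv (by
        rw [← Fin.last_add_one] at h0
        exact add_right_cancel h0)
      have h5 : ∀ q : Qubits (k * m), q = fun i =>
          outgoing v q (v + 1) (Fin.cast (by
            have := rightMsg_sub_one (k * m) hv'
            rw [add_sub_cancel_right] at this
            exact this.symm) i) := fun q => rfl
      apply (msgEquiv k m).symm.injective
      rw [h5 ((msgEquiv k m).symm fun i => u i true), h3, ← h5]
  funext i b
  cases b
  exacts [congrFun h1 i, congrFun h4 i]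

/-- The registers that a node tests after the communication round, and the rest of its memory. -/
noncomputable def recvMap (k m : ℕ) (v : Fin (r + 1))
    (z : NodeMem k m × ∀ w, Qubits (rightMsg r (k * m) w v)) :
    (Fin k → Bool → Qubits m) × (Bool × (Fin k → Qubits m)) :=
  (fun i b => if b then msgEquiv k m (incoming v z.2) i else z.1.2.1 i, (z.1.1, z.1.2.2))

theorem recvMap_injective (v : Fin (r + 1)) : Function.Injective (recvMap k m v) := by
  rintro ⟨⟨b, a, l⟩, q⟩ ⟨⟨b', a', l'⟩, q'⟩ h
  simp only [recvMap, Prod.mk.injEq] at h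
  obtain ⟨h1, h2, h3⟩ := h
  have h4 : a = a' := by
    funext i
    simpa using congrFun (congrFun h1 i) false
  have h5 : q = q' := by
    apply incoming_injective
    apply (msgEquiv k m).injective
    funext i
    simpa using congrFun (congrFun h1 i) true
  rw [h2, h3, h4, h5]

/-- The final test of node `v`: the first test was passed, and the `k` pairs of registers pass the
second test. -/
noncomputable def nodeAccept (k m : ℕ) (v : Fin (r + 1)) :
    Matrix (NodeMem k m × ∀ w, Qubits (rightMsg r (k * m) w v))
      (NodeMem k m × ∀ w, Qubits (rightMsg r (k * m) w v)) ℂ :=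
  -- Block diagonality in `o` means that the recorded bit and the kept right registers are left
  -- untouched; blocks with a failed first test vanish.
  (Matrix.blockDiagonal fun o : Bool × (Fin k → Qubits m) =>
    if o.1 then tensorAll (fun _ : Fin k => edgeTest (Qubits m) v) else 0).submatrix
      (recvMap k m v) (recvMap k m v)

theorem isPOVMElement_nodeAccept (v : Fin (r + 1)) : IsPOVMElement (nodeAccept k m v) := by
  refine IsPOVMElement.submatrix (IsStarProjection.isPOVMElement ?_) (recvMap_injective v)
  have h : ∀ o : Bool × (Fin k → Qubits m), IsStarProjection
      (if o.1 then tensorAll (fun _ : Fin k => edgeTest (Qubits m) v) else 0) := fun o => by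
    split_ifs
    exacts [.tensorAll fun _ => isStarProjection_edgeTest v, .zero _]
  constructor
  · rw [IsIdempotentElem, ← Matrix.blockDiagonal_mul]
    congr 1
    funext o
    exact (h o).isIdempotentElem
  · rw [IsSelfAdjoint, Matrix.star_eq_conjTranspose, Matrix.blockDiagonal_conjTranspose]
    congr 1
    funext o
    exact (h o).isSelfAdjoint

theorem nodeAccept_apply_of_false (v : Fin (r + 1))
    (z z' : NodeMem k m × ∀ w, Qubits (rightMsg r (k * m) w v)) (h : z.1.1 = false) :
    nodeAccept k m v z z' = 0 := by
  rw [nodeAccept, Matrix.submatrix_apply, Matrix.blockDiagonal_apply]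
  simp [recvMap, h]

/-- The first test of node `v` on its `k` pairs of registers. -/
noncomputable def nodeCheck (k : ℕ) {X : Type} [DecidableEq X] (α : Fin (r + 1) → X → ℂ)
    (v : Fin (r + 1)) : Matrix (Fin k → Bool → X) (Fin k → Bool → X) ℂ :=
  tensorAll fun _ : Fin k => nodeTest α v

theorem isStarProjection_nodeCheck {X : Type} [Fintype X] [DecidableEq X]
    {α : Fin (r + 1) → X → ℂ} (hα : ∀ v, star (α v) ⬝ᵥ α v = 1) (v : Fin (r + 1)) :
    IsStarProjection (nodeCheck k α v) :=
  .tensorAll fun _ => isStarProjection_nodeTest hα v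

/-- Groups the registers of all nodes by copies. -/
def copyEquiv (r k : ℕ) (X : Type) :
    (Fin (r + 1) → Fin k → Bool → X) ≃ (Fin k → Fin (r + 1) × Bool → X) where
  toFun u i p := u p.1 i p.2
  invFun s v i b := s i (v, b)
  left_inv _ := rfl
  right_inv _ := rfl

theorem tensorAll_nodeCheck {X : Type} [DecidableEq X] (α : Fin (r + 1) → X → ℂ) :
    tensorAll (nodeCheck k α) = (tensorAll fun _ : Fin k => pairOp 1 (nodeTest α)).submatrix
      (copyEquiv r k X) (copyEquiv r k X) := by
  ext u u'
  simp only [tensorAll, nodeCheck, pairOp, Matrix.submatrix_apply]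
  rw [Finset.prod_comm]
  rfl

/-- Each factor at `v ≠ 0` compares the left registers of `v` with the right registers of `v - 1`.
The two sides differ only in the place of the identity on the last node's right registers: it comes
from the memory of the last node on the left, and from the cyclic pairing at node `0` on the right.
-/
theorem prod_nodeAccept_sendMap (u u' : Fin (r + 1) → Fin k → Bool → Qubits m) :
    ∏ v, nodeAccept k m v
      ((sendMap k m v true (u v)).1, fun w => (sendMap k m w true (u w)).2 v)
      ((sendMap k m v true (u' v)).1, fun w => (sendMap k m w true (u' w)).2 v) =
    (tensorAll fun _ : Fin k => pairOp (shiftPerm r) (edgeTest (Qubits m)))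
      (copyEquiv r k _ u) (copyEquiv r k _ u') := by
  have hR : (tensorAll fun _ : Fin k => pairOp (shiftPerm r) (edgeTest (Qubits m)))
      (copyEquiv r k _ u) (copyEquiv r k _ u') = ∏ v, tensorAll
        (fun _ : Fin k => edgeTest (Qubits m) v)
        (fun i b => if b then u (v - 1) i true else u v i false)
        (fun i b => if b then u' (v - 1) i true else u' v i false) := by
    simp only [tensorAll, pairOp, Matrix.submatrix_apply]
    rw [Finset.prod_comm]
    refine Finset.prod_congr rfl fun v _ => Finset.prod_congr rfl fun i _ => ?_
    congr 1 <;>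
    · funext b
      cases b <;> simp [pairEquiv, shiftPerm, copyEquiv]
  rw [hR]
  have h1 : ∀ x y : Fin k → Bool → Qubits m,
      tensorAll (fun _ : Fin k => edgeTest (Qubits m) (0 : Fin (r + 1))) x y =
        if x = y then 1 else 0 := fun x y => by
    have h2 : (fun _ : Fin k => edgeTest (Qubits m) (0 : Fin (r + 1))) = fun _ => 1 := by
      funext i
      exact if_pos rfl
    rw [h2, tensorAll_one, Matrix.one_apply]
  have hL : ∀ v, nodeAccept k m v
      ((sendMap k m v true (u v)).1, fun w => (sendMap k m w true (u w)).2 v)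
      ((sendMap k m v true (u' v)).1, fun w => (sendMap k m w true (u' w)).2 v) =
      if v = Fin.last r → ∀ i, u v i true = u' v i true then
        tensorAll (fun _ : Fin k => edgeTest (Qubits m) v)
        (fun i b => if b then (if v = 0 then msgEquiv k m (fun _ => false) i else u (v - 1) i true)
          else u v i false)
        (fun i b => if b then (if v = 0 then msgEquiv k m (fun _ => false) i
          else u' (v - 1) i true) else u' v i false)
      else 0 := fun v => by
    have h3 : ∀ u : Fin (r + 1) → Fin k → Bool → Qubits m,
        recvMap k m v ((sendMap k m v true (u v)).1, fun w => (sendMap k m w true (u w)).2 v) =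
        (fun i b => if b then (if v = 0 then msgEquiv k m (fun _ => false) i
          else u (v - 1) i true) else u v i false,
          (true, fun i => if v = Fin.last r then u v i true else fun _ => false)) := fun u => by
      refine Prod.ext ?_ rfl
      funext i b
      cases b
      · rfl
      · simp only [recvMap, sendMap, if_true]
        by_cases hv : v = 0
        · subst hv
          rw [incoming_zero, if_pos rfl]
        · rw [if_neg hv, incoming_outgoing hv fun w => (msgEquiv k m).symm fun i => u w i true,
            Equiv.apply_symm_apply]
    rw [nodeAccept, Matrix.submatrix_apply, Matrix.blockDiagonal_apply, h3, h3]
    have h4 : ((true, fun i => if v = Fin.last r then u v i true else fun _ => false) =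
        ((true, fun i => if v = Fin.last r then u' v i true else fun _ => false) :
          Bool × (Fin k → Qubits m))) ↔ (v = Fin.last r → ∀ i, u v i true = u' v i true) := by
      by_cases hv : v = Fin.last r
      · simp [hv, funext_iff]
      · simp [hv]
    simp only [h4, if_true]
  simp only [hL]
  -- If the last right registers agree, the factors match node by node; otherwise both products
  -- vanish, at the last node and at node `0` respectively.
  by_cases h : ∀ i, u (Fin.last r) i true = u' (Fin.last r) i true
  · refine Finset.prod_congr rfl fun v _ => ?_
    rw [if_pos (by rintro rfl; exact h)]
    by_cases hv : v = 0
    · subst hv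
      rw [h1, h1]
      have h0 : (0 - 1 : Fin (r + 1)) = Fin.last r := by
        rw [sub_eq_iff_eq_add, Fin.last_add_one]
      simp only [h0, h]
      congr 1
      simp [funext_iff]
    · simp only [hv, if_false]
  · rw [Finset.prod_eq_zero (Finset.mem_univ (Fin.last r)) (if_neg fun h' => h (h' rfl))]
    symm
    apply Finset.prod_eq_zero (Finset.mem_univ 0)
    rw [h1, if_neg]
    intro h'
    have h0 : (0 - 1 : Fin (r + 1)) = Fin.last r := by
      rw [sub_eq_iff_eq_add, Fin.last_add_one]
    exact h fun i => by simpa [h0] using congrFun (congrFun h' i) true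

end Layout

/-! ### The fingerprint protocol and its acceptance operator -/

section Protocol

variable {r n m : ℕ}

/-- The fingerprints held by the nodes; only the ends use theirs. -/
def nodeFingerprint (ψ : BitString n → Qubits m → ℂ) (inp : Fin (r + 1) → Option (BitString n))
    (v : Fin (r + 1)) : Qubits m → ℂ :=
  ψ ((inp v).getD fun _ => false)

/-- The Kraus operators of the sending step: the node performs its first test, remembers the
outcome `b`, and passes its right registers to its right neighbour. -/
noncomputable def sendKraus (k : ℕ) (α : Fin (r + 1) → Qubits m → ℂ) (v : Fin (r + 1))
    (b : Bool) :
    Matrix (NodeMem k m × ∀ w, Qubits (rightMsg r (k * m) v w)) (Qubits (k * (2 * m))) ℂ :=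
  (basisMap (sendMap k m v b) *
    if b then nodeCheck k α v else 1 - nodeCheck k α v).submatrix id (certEquiv k m)

theorem sum_sendKraus (k : ℕ) {α : Fin (r + 1) → Qubits m → ℂ}
    (hα : ∀ v, star (α v) ⬝ᵥ α v = 1) (v : Fin (r + 1)) :
    ∑ b, (sendKraus k α v b)ᴴ * sendKraus k α v b = 1 := by
  have h : ∀ b, (sendKraus k α v b)ᴴ * sendKraus k α v b =
      (if b then nodeCheck k α v else 1 - nodeCheck k α v).submatrix
        (certEquiv k m) (certEquiv k m) := fun b => by
    have hP : IsStarProjection (if b then nodeCheck k α v else 1 - nodeCheck k α v) := by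
      split_ifs
      exacts [isStarProjection_nodeCheck hα v, (isStarProjection_nodeCheck hα v).one_sub]
    rw [sendKraus, Matrix.conjTranspose_submatrix, ← Matrix.submatrix_mul _ _ _ id _
      Function.bijective_id, Matrix.conjTranspose_mul, Matrix.mul_assoc,
      ← Matrix.mul_assoc (basisMap _)ᴴ, conjTranspose_basisMap_mul_self (sendMap_injective v b)]
    rw [Matrix.one_mul, ← Matrix.star_eq_conjTranspose, hP.isSelfAdjoint.star_eq,
      hP.isIdempotentElem.eq]
  simp only [h, Fintype.sum_bool, if_true, Bool.false_eq_true, if_false]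
  rw [← Pi.add_apply, ← Pi.add_apply, ← Matrix.submatrix_add]
  simp

/-- The protocol in which the ends hold fingerprints `ψ` of their inputs, with `k` copies of the
basic test. -/
noncomputable def fingerprintProtocol (r k : ℕ) (ψ : BitString n → Qubits m → ℂ)
    (hψ : ∀ x, star (ψ x) ⬝ᵥ ψ x = 1) : DQMAProtocol (SimpleGraph.pathGraph (r + 1)) n where
  cert _ := k * (2 * m)
  msg := rightMsg r (k * m)
  msg_eq_zero := rightMsg_eq_zero (k * m)
  Mem _ := NodeMem k m
  send v inp :=
    { Idx := Bool
      kraus := sendKraus k (nodeFingerprint ψ fun _ => inp) v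
      sum_kraus := sum_sendKraus k (fun _ => hψ _) v }
  accept v _ := nodeAccept k m v
  accept_isPOVMElement v _ := isPOVMElement_nodeAccept v

/-- The certificates grouped by copies. -/
noncomputable def certsEquiv (r k m : ℕ) :
    (Fin (r + 1) → Qubits (k * (2 * m))) ≃ (Fin k → Fin (r + 1) × Bool → Qubits m) :=
  (Equiv.piCongrRight fun _ => certEquiv k m).trans (copyEquiv r k (Qubits m))

theorem tensorAll_sendKraus (k : ℕ) (α : Fin (r + 1) → Qubits m → ℂ) (b : Fin (r + 1) → Bool) :
    tensorAll (fun v => sendKraus k α v (b v)) =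
      (basisMap (fun (u : Fin (r + 1) → Fin k → Bool → Qubits m) v => sendMap k m v (b v) (u v)) *
        tensorAll fun v => if b v then nodeCheck k α v else 1 - nodeCheck k α v).submatrix
          id (Equiv.piCongrRight fun _ => certEquiv k m) := by
  rw [← tensorAll_basisMap, tensorAll_mul]
  rfl

theorem prod_nodeAccept_sendMap_eq_zero (k : ℕ) (b : Fin (r + 1) → Bool) {v₀ : Fin (r + 1)}
    (h : b v₀ = false) (u u' : Fin (r + 1) → Fin k → Bool → Qubits m) :
    ∏ v, nodeAccept k m v
      ((sendMap k m v (b v) (u v)).1, fun w => (sendMap k m w (b w) (u w)).2 v)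
      ((sendMap k m v (b v) (u' v)).1, fun w => (sendMap k m w (b w) (u' w)).2 v) = 0 :=
  Finset.prod_eq_zero (Finset.mem_univ v₀) (nodeAccept_apply_of_false _ _ _ h)

/-- When all first tests succeed, node tests surround edge tests, and regrouping by copies factors
the product into `k` operators `P Q P`. A single recorded failure kills the whole product. -/
theorem conjTranspose_tensorAll_sendKraus_mul_mul (k : ℕ) {α : Fin (r + 1) → Qubits m → ℂ}
    (hα : ∀ v, star (α v) ⬝ᵥ α v = 1) (b : Fin (r + 1) → Bool)
    (T : Matrix (∀ v : Fin (r + 1), NodeMem k m × ∀ w, Qubits (rightMsg r (k * m) v w))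
      (∀ v : Fin (r + 1), NodeMem k m × ∀ w, Qubits (rightMsg r (k * m) v w)) ℂ)
    (hT : ∀ s t, T s t = ∏ v, nodeAccept k m v ((s v).1, fun w => (s w).2 v)
      ((t v).1, fun w => (t w).2 v)) :
    (tensorAll fun v => sendKraus k α v (b v))ᴴ * T * (tensorAll fun v => sendKraus k α v (b v)) =
      if b = fun _ => true then (tensorAll fun _ : Fin k => copyAccept α).submatrix
        (certsEquiv r k m) (certsEquiv r k m) else 0 := by
  set F := fun (u : Fin (r + 1) → Fin k → Bool → Qubits m) v => sendMap k m v (b v) (u v)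
  set R := tensorAll fun v => if b v then nodeCheck k α v else 1 - nodeCheck k α v with hR
  have h1 : (tensorAll fun v => sendKraus k α v (b v))ᴴ * T *
      (tensorAll fun v => sendKraus k α v (b v)) = (Rᴴ * T.submatrix F F * R).submatrix
        (Equiv.piCongrRight fun _ => certEquiv k m) (Equiv.piCongrRight fun _ => certEquiv k m) := by
    have h2 : Rᴴ * T.submatrix F F * R = (basisMap F * R)ᴴ * T * (basisMap F * R) := by
      rw [← conjTranspose_basisMap_mul_mul T F, Matrix.conjTranspose_mul]
      simp only [Matrix.mul_assoc]
    rw [tensorAll_sendKraus, h2]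
    rfl
  rw [h1]
  split_ifs with hb
  · have hR' : R = (tensorAll fun _ : Fin k => pairOp 1 (nodeTest α)).submatrix
        (copyEquiv r k _) (copyEquiv r k _) := by
      rw [hR, ← tensorAll_nodeCheck]
      simp [hb]
    have hRs : Rᴴ = R := by
      have : IsStarProjection R := by
        rw [hR]
        simp only [hb, if_true]
        exact .tensorAll fun v => isStarProjection_nodeCheck hα v
      exact this.isSelfAdjoint
    have hTF : T.submatrix F F = (tensorAll fun _ : Fin k =>
        pairOp (shiftPerm r) (edgeTest (Qubits m))).submatrix
        (copyEquiv r k _) (copyEquiv r k _) := by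
      ext u u'
      rw [Matrix.submatrix_apply, hT, Matrix.submatrix_apply, ← prod_nodeAccept_sendMap]
      simp only [F, hb]
    rw [hRs, hTF, hR', Matrix.submatrix_mul_equiv, Matrix.submatrix_mul_equiv, tensorAll_mul,
      tensorAll_mul]
    rfl
  · obtain ⟨v₀, hv₀⟩ := Function.ne_iff.mp hb
    have hTF : T.submatrix F F = 0 := by
      ext u u'
      rw [Matrix.submatrix_apply, hT]
      exact prod_nodeAccept_sendMap_eq_zero k b (by simpa using hv₀) u u'
    rw [hTF]
    simp

theorem acceptProb_fingerprintProtocol (k : ℕ) (ψ : BitString n → Qubits m → ℂ)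
    (hψ : ∀ x, star (ψ x) ⬝ᵥ ψ x = 1) (inp : Fin (r + 1) → Option (BitString n))
    (ρ : Matrix (fingerprintProtocol r k ψ hψ).Certs (fingerprintProtocol r k ψ hψ).Certs ℂ) :
    (fingerprintProtocol r k ψ hψ).acceptProb inp ρ =
      ((tensorAll fun _ : Fin k => copyAccept (nodeFingerprint ψ inp)) *
        ρ.submatrix (certsEquiv r k m).symm (certsEquiv r k m).symm).trace.re := by
  have h := conjTranspose_tensorAll_sendKraus_mul_mul k (α := nodeFingerprint ψ inp)
    (fun _ => hψ _)
  refine DQMAProtocol.acceptProb_eq_of_single (fingerprintProtocol r k ψ hψ) inp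
    (certsEquiv r k m) _ (fun _ => true) ?_ (fun b hb => ?_) ρ
  · exact (h _ _ fun s t => rfl).trans (if_pos rfl)
  · exact (h _ _ fun s t => rfl).trans (if_neg hb)

end Protocol

/-! ### Reed-Solomon fingerprints -/

section Fingerprint

open Polynomial in
-- Points of agreement are roots of the difference, a nonzero polynomial of degree less than `n`.
theorem card_filter_eval_ofFn_eq_le {F : Type} [Field F] [Fintype F] [DecidableEq F] {n : ℕ}
    {x y : Fin n → F} (h : x ≠ y) :
    (Finset.univ.filter fun a => (ofFn n x).eval a = (ofFn n y).eval a).card ≤ n := by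
  set p := ofFn n (x - y) with hp
  have hp0 : p ≠ 0 := fun h0 => h (by
    funext i
    have := congrArg (fun q : F[X] => q.coeff i) h0
    simp only [hp, ofFn_coeff_eq_val_of_lt _ i.2, coeff_zero] at this
    exact sub_eq_zero.mp this)
  calc (Finset.univ.filter fun a => (ofFn n x).eval a = (ofFn n y).eval a).card
      ≤ p.roots.toFinset.card := by
        refine Finset.card_le_card fun a ha => ?_
        rw [Multiset.mem_toFinset, mem_roots hp0, IsRoot.def, hp, map_sub, eval_sub,
          (Finset.mem_filter.mp ha).2, sub_self]
    _ ≤ p.roots.card := p.roots.toFinset_card_le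
    _ ≤ p.natDegree := p.card_roots'
    _ ≤ n := by
        rcases Nat.eq_zero_or_pos n with rfl | hn
        · exact (h (Subsingleton.elim _ _)).elim
        · exact (ofFn_natDegree_lt hn _).le

/-- Reed-Solomon fingerprints. -/
theorem exists_fingerprint (n : ℕ) :
    ∃ ψ : BitString n → Qubits (2 * (Nat.log 2 n + 2)) → ℂ,
      (∀ x, star (ψ x) ⬝ᵥ ψ x = 1) ∧
      ∀ x y, x ≠ y → Complex.normSq (star (ψ x) ⬝ᵥ ψ y) ≤ 1 / 4 := by
  classical
  -- The field has `2 ^ κ ≥ 2 * n` elements, so distinct codewords agree on at most half of the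
  -- points.
  set κ := Nat.log 2 n + 2 with hκ
  let F := GaloisField 2 κ
  have : Fintype F := Fintype.ofFinite F
  have hF : Fintype.card F = 2 ^ κ := by
    rw [← Nat.card_eq_fintype_card]
    exact GaloisField.card 2 κ (by omega)
  have hQ : 2 * n ≤ 2 ^ κ := by
    have := Nat.lt_pow_succ_log_self (b := 2) (by norm_num) n
    rw [hκ, pow_succ]
    omega
  let e : F × F ≃ Qubits (2 * κ) := Fintype.equivOfCardEq (by
    rw [Fintype.card_prod, hF]
    simp [two_mul, pow_add])
  let E : BitString n → Fin n → F := fun x i => if x i then 1 else 0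
  have hE : Function.Injective E := fun x y h => by
    funext i
    have := congrFun h i
    cases hx : x i <;> cases hy : y i <;> simp [E, hx, hy] at this ⊢
  let c : ℝ := (Real.sqrt (2 ^ κ))⁻¹
  have hc : (c : ℂ) * c = ((2 : ℝ) ^ κ)⁻¹ := by
    rw [← Complex.ofReal_mul, ← mul_inv, Real.mul_self_sqrt (by positivity)]
  let g : BitString n → F → F := fun x a => (Polynomial.ofFn n (E x)).eval a
  -- The uniform superposition of the basis states `(a, g x a)` over the field elements `a`.
  let ψ : BitString n → Qubits (2 * κ) → ℂ := fun x q =>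
    if (e.symm q).2 = g x (e.symm q).1 then (c : ℂ) else 0
  -- The inner product is the fraction of points where the two polynomials agree.
  have hdot : ∀ x y, star (ψ x) ⬝ᵥ ψ y =
      (((Finset.univ.filter fun a => g x a = g y a).card : ℝ) / 2 ^ κ : ℝ) := fun x y => by
    have h1 : star (ψ x) ⬝ᵥ ψ y = ∑ a : F, if g x a = g y a then (c : ℂ) * c else 0 := by
      rw [dotProduct, ← Equiv.sum_comp e, Fintype.sum_prod_type]
      refine Finset.sum_congr rfl fun a _ => ?_
      rw [Finset.sum_eq_single (g x a)]
      · by_cases h : g x a = g y a <;> simp [ψ, h]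
      · intro b _ hb
        simp [ψ, hb]
      · simp
    rw [h1, ← Finset.sum_filter, Finset.sum_const, hc, nsmul_eq_mul]
    push_cast
    rw [div_eq_mul_inv]
  refine ⟨ψ, fun x => ?_, fun x y hxy => ?_⟩
  · rw [hdot]
    simp [hF]
  · rw [hdot, Complex.normSq_ofReal]
    have h1 : ((Finset.univ.filter fun a => g x a = g y a).card : ℝ) ≤ n := by
      exact_mod_cast card_filter_eval_ofFn_eq_le (hE.ne hxy)
    have h2 : (2 * n : ℝ) ≤ 2 ^ κ := by exact_mod_cast hQ
    have h3 : ((Finset.univ.filter fun a => g x a = g y a).card : ℝ) / 2 ^ κ ≤ 1 / 2 := by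
      rw [div_le_iff₀ (by positivity)]
      linarith
    have h4 : (0 : ℝ) ≤ ((Finset.univ.filter fun a => g x a = g y a).card : ℝ) / 2 ^ κ := by
      positivity
    nlinarith

end Fingerprint

/-! ### Completeness, soundness and sizes -/

theorem star_prod_dotProduct_prod {V A : Type} [Fintype V] [DecidableEq V] [Fintype A]
    {f : A → ℂ} (hf : star f ⬝ᵥ f = 1) :
    star (fun s : V → A => ∏ v, f (s v)) ⬝ᵥ (fun s : V → A => ∏ v, f (s v)) = 1 := by
  have h := Finset.prod_univ_sum (fun _ : V => (Finset.univ : Finset A)) fun _ a => star f a * f a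
  rw [Fintype.piFinset_univ] at h
  calc _ = ∑ s : V → A, ∏ v, star f (s v) * f (s v) := by
        simp [dotProduct, Finset.prod_mul_distrib]
    _ = ∏ _v : V, star f ⬝ᵥ f := h.symm
    _ = 1 := by simp [hf]

theorem IsDensityMatrix.submatrix_equiv {A B : Type} [Fintype A] [Fintype B]
    {ρ : Matrix A A ℂ} (h : IsDensityMatrix ρ) (e : B ≃ A) :
    IsDensityMatrix (ρ.submatrix e e) :=
  ⟨h.1.submatrix e, (Equiv.sum_comp e fun a => ρ a a).trans h.2⟩

theorem isDensityMatrix_ketBra {A : Type} [Fintype A] {ψ : A → ℂ} (h : star ψ ⬝ᵥ ψ = 1) :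
    IsDensityMatrix (ketBra ψ) := by
  refine ⟨(isStarProjection_ketBra h).posSemidef, ?_⟩
  rw [ketBra, Matrix.trace_vecMulVec, dotProduct_comm, h]

theorem IsDensityMatrix.re_trace_mul_le {A : Type} [Fintype A] [DecidableEq A]
    {M ρ : Matrix A A ℂ} (hρ : IsDensityMatrix ρ) {c : ℝ}
    (h : ((c : ℂ) • 1 - M).PosSemidef) : (M * ρ).trace.re ≤ c := by
  have h1 := h.trace_mul_nonneg hρ.1
  rw [Matrix.sub_mul, Matrix.trace_sub, Matrix.smul_mul, Matrix.one_mul, Matrix.trace_smul, hρ.2,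
    smul_eq_mul, mul_one] at h1
  have h2 := (Complex.le_def.mp h1).1
  rw [Complex.sub_re, Complex.ofReal_re, Complex.zero_re] at h2
  linarith

theorem one_sub_pow_le_one_third {r : ℕ} (hr : 1 ≤ r) :
    (1 - 1 / (16 * (r : ℝ) ^ 2)) ^ (32 * r ^ 2) ≤ 1 / 3 := by
  have hR : (1 : ℝ) ≤ r := by exact_mod_cast hr
  have h0 : 0 ≤ 1 - 1 / (16 * (r : ℝ) ^ 2) := by
    rw [sub_nonneg, div_le_one (by positivity)]
    nlinarith
  calc (1 - 1 / (16 * (r : ℝ) ^ 2)) ^ (32 * r ^ 2)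
      ≤ Real.exp (-(1 / (16 * (r : ℝ) ^ 2))) ^ (32 * r ^ 2) :=
        pow_le_pow_left₀ h0 (Real.one_sub_le_exp_neg _) _
    _ = Real.exp (-2) := by
        rw [← Real.exp_nat_mul]
        congr 1
        push_cast
        field_simp
        norm_num
    -- `e² ≥ 1 + 2 = 3`.
    _ ≤ 1 / 3 := by
        rw [Real.exp_neg, one_div]
        exact inv_anti₀ (by norm_num) (by linarith [Real.add_one_le_exp (2 : ℝ)])

theorem decides_fingerprintProtocol {n m r : ℕ} (hr : 1 ≤ r) (ψ : BitString n → Qubits m → ℂ)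
    (hψ : ∀ x, star (ψ x) ⬝ᵥ ψ x = 1)
    (h : ∀ x y, x ≠ y → Complex.normSq (star (ψ x) ⬝ᵥ ψ y) ≤ 1 / 4) :
    (fingerprintProtocol r (32 * r ^ 2) ψ hψ).Decides 0 (Fin.last r) (EQ n) 1 (1 / 3) := by
  intro x y
  have hlast : Fin.last r ≠ 0 := by
    rw [Ne, Fin.ext_iff]
    simp
    omega
  have h0 : nodeFingerprint ψ (DQMAProtocol.localInput 0 (Fin.last r) x y) 0 = ψ x := by
    simp [nodeFingerprint, DQMAProtocol.localInput]
  have h1 : nodeFingerprint ψ (DQMAProtocol.localInput 0 (Fin.last r) x y) (Fin.last r) = ψ y := by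
    simp [nodeFingerprint, DQMAProtocol.localInput, hlast]
  constructor
  · intro hxy
    obtain rfl : x = y := of_decide_eq_true hxy
    -- The honest certificate is the fingerprint of `x` in every register of every copy; the product
    -- lemma is applied over registers, then over copies.
    have hΨ := star_prod_dotProduct_prod (V := Fin (32 * r ^ 2))
      (star_prod_dotProduct_prod (V := Fin (r + 1) × Bool) (hψ x))
    set Ψ := fun t : Fin (32 * r ^ 2) → Fin (r + 1) × Bool → Qubits m =>
      ∏ i, ∏ p, ψ x (t i p) with hΨ'
    set e := certsEquiv r (32 * r ^ 2) m
    have h2 : ((tensorAll fun _ : Fin (32 * r ^ 2) => copyAccept (nodeFingerprint ψ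
        (DQMAProtocol.localInput 0 (Fin.last r) x x))) *
          ((ketBra Ψ).submatrix e e).submatrix e.symm e.symm).trace = 1 := by
      rw [Matrix.submatrix_submatrix, Equiv.self_comp_symm, Matrix.submatrix_id_id, ketBra,
        Matrix.mul_vecMulVec, hΨ', tensorAll_mulVec_prod _
        fun _ (s : Fin (r + 1) × Bool → Qubits m) => ∏ p, ψ x (s p), Matrix.trace_vecMulVec]
      simp only [copyAccept_mulVec_prod (hψ x) h0 h1]
      rw [dotProduct_comm, hΨ]
    refine ⟨_, (isDensityMatrix_ketBra hΨ).submatrix_equiv e, ?_⟩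
    refine le_of_le_of_eq ?_ (acceptProb_fingerprintProtocol _ ψ hψ _ _).symm
    exact (congrArg Complex.re h2).ge
  · intro hxy ρ hρ
    have hxy' : y ≠ x := fun h' => of_decide_eq_false hxy h'.symm
    rw [acceptProb_fingerprintProtocol]
    -- The bound on one copy passes to its tensor power, and then to every state of the
    -- certificates, entangled or not.
    refine ((hρ.submatrix_equiv (certsEquiv r (32 * r ^ 2) m).symm).re_trace_mul_le
      ((posSemidef_copyAccept fun _ => hψ _).smul_one_sub_tensorAll
        (posSemidef_smul_one_sub_copyAccept hr (fun _ => hψ _) ?_) _)).trans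
      (one_sub_pow_le_one_third hr)
    change Complex.normSq (star (nodeFingerprint ψ _ (Fin.last r)) ⬝ᵥ nodeFingerprint ψ _ 0) ≤ _
    rw [h0, h1]
    exact h y x hxy'

/-- The path `v₀, …, v_r` of length `r` is `SimpleGraph.pathGraph (r + 1)`; its ends `0` and
`Fin.last r` hold the inputs. The constant `C` does not depend on `n` and `r`. -/
theorem mainTheorem3 :
    ∃ C : ℝ, 0 < C ∧ ∀ n r : ℕ, 2 ≤ n → 1 ≤ r →
      ∃ P : DQMAProtocol (SimpleGraph.pathGraph (r + 1)) n,
        P.Decides 0 (Fin.last r) (EQ n) 1 (1 / 3) ∧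
        (P.certSize : ℝ) ≤ C * (r : ℝ) ^ 2 * Real.logb 2 (n : ℝ) ∧
        (P.msgSize : ℝ) ≤ C * (r : ℝ) ^ 2 * Real.logb 2 ((n : ℝ) + (r : ℝ)) := by
  -- A certificate has `128 r² (Nat.log 2 n + 2)` qubits, and `logb 2 n ≥ 1` bounds `Nat.log 2 n +
  -- 2` by `3 * logb 2 n`.
  refine ⟨384, by norm_num, fun n r hn hr => ?_⟩
  obtain ⟨ψ, hψ, h⟩ := exists_fingerprint n
  have hn' : (2 : ℝ) ≤ n := by exact_mod_cast hn
  have hlog1 : 1 ≤ Real.logb 2 (n : ℝ) := by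
    rw [Real.le_logb_iff_rpow_le (by norm_num) (by linarith)]
    simpa using hn'
  have hlog : (Nat.log 2 n : ℝ) ≤ Real.logb 2 n := by
    exact_mod_cast Real.natLog_le_logb n 2
  have hsize : ((32 * r ^ 2 * (2 * (2 * (Nat.log 2 n + 2))) : ℕ) : ℝ) ≤
      384 * (r : ℝ) ^ 2 * Real.logb 2 (n : ℝ) := by
    push_cast
    nlinarith [sq_nonneg (r : ℝ)]
  refine ⟨fingerprintProtocol r (32 * r ^ 2) ψ hψ, decides_fingerprintProtocol hr ψ hψ h, ?_, ?_⟩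
  · refine le_trans ?_ hsize
    rw [Nat.cast_le]
    exact Finset.sup_le fun v _ => le_rfl
  · have hmono : Real.logb 2 (n : ℝ) ≤ Real.logb 2 ((n : ℝ) + (r : ℝ)) :=
      Real.logb_le_logb_of_le (by norm_num) (by linarith) (by simp)
    refine le_trans ?_ (hsize.trans (mul_le_mul_of_nonneg_left hmono (by positivity)))
    rw [Nat.cast_le]
    -- Bounding each direction by the full `k * m` qubits already gives the size of a certificate.
    refine Finset.sup_le fun e _ => ?_
    have h1 := rightMsg_le (32 * r ^ 2 * (2 * (Nat.log 2 n + 2))) e.1 e.2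
    have h2 := rightMsg_le (32 * r ^ 2 * (2 * (Nat.log 2 n + 2))) e.2 e.1
    change rightMsg r _ e.1 e.2 + rightMsg r _ e.2 e.1 ≤ _
    calc _ ≤ _ := add_le_add h1 h2
      _ = _ := by ring
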